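/- **Conventions.** Let $K$ be a field. For a finite quiver $Q$ with relations generating an ideal $I$ of the path algebra $KQ$ (paths are written in the order in which the arrows are traversed), put $\Lambda=KQ/I$, $P_i=e_i\Lambda$, and let the Cartan matrix be $C_Q=(\dim_K\operatorname{Hom}_\Lambda(P_j,P_i))_{i,j}$, indexed by the vertices. *Type $A$.* If $Q$ is a quiver (without loops and oriented 2-cycles) that is mutation equivalent to $A_n$, $n\ge 1$, a *triangle* of $Q$ is an oriented 3-cycle, $t(Q)$ is the number of triangles, and the relations (defining the cluster-tilted algebra with quiver $Q$) say that the product of any two consecutive arrows of a triangle is zero. A *rooted quiver of type $A$* is such a $Q$ with a chosen vertex $v$, the root, such that, if $n\ge 2$, either exactly one arrow is incident to $v$, or exactly two arrows are incident to $v$ and they belong to a common triangle. *Gluing.* Rooted quivers of type $A$ are glued to a quiver with relations (the skeleton) at distinct vertices by taking the disjoint union and identifying each root with the corresponding vertex of the skeleton; the relations of the gluing are the union of all the relations. *Type $D$.* The cluster-tilted algebras of type $D_n$ ($n\ge 4$) are given by the following quivers $Q$ with relations. - Type I: a rooted quiver $Q'$ of type $A$ glued at $c$ to one of $a\to c\to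 b$, $a\to c\leftarrow b$, $a\leftarrow c\to b$ (no relations). - Type II: rooted quivers $Q',Q''$ of type $A$ glued at $c',c''$ to the quiver with arrows $\alpha:c'\to b$, $\beta:b\to c''$, $\gamma:c'\to a$, $\delta:a\to c''$, $\varepsilon:c''\to c'$ and relations $\alpha\beta=\gamma\delta$, $\varepsilon\alpha=\varepsilon\gamma=\beta\varepsilon=\delta\varepsilon=0$. - Type III: rooted quivers $Q',Q''$ of type $A$ glued at $c',c''$ to the oriented 4-cycle $\alpha:c'\to b$, $\beta:b\to c''$, $\gamma:c''\to a$, $\delta:a\to c'$ with relations $\alpha\beta\gamma=\beta\gamma\delta=\gamma\delta\alpha=\delta\alpha\beta=0$. - Type IV: let $m\ge 3$ and let $i_1<\dots<i_r$ ($r\ge 0$) be elements of $\{1,\dots,m\}$. The skeleton has vertices $1,\dots,m,c_1,\dots,c_r$, the arrows $i\to i+1$ of the *central cycle* (indices modulo $m$), and for each $j$ arrows $i_j+1\to c_j$ and $c_j\to i_j$, which form together with $i_j\to i_j+1$ a *spike*. Its relations: for every $j$, the paths $i_j\to i_j+1\to c_j$ and $c_j\to i_j\to i_j+1$ are zero,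 and the path $i_j+1\to c_j\to i_j$ equals the path of length $m-1$ from $i_j+1$ to $i_j$ along the central cycle; for $i\notin\{i_1,\dots,i_r\}$ the path of length $m-1$ from $i+1$ to $i$ along the central cycle is zero. Rooted quivers $Q^{(1)},\dots,Q^{(r)}$ of type $A$ are glued at $c_1,\dots,c_r$. Let $c(Q)$ be the number of vertices of the central cycle that belong to two spikes. **Theorem.** 1. If $Q$ is of type I, then $\det C_Q=2^{t(Q')}=\det C_{Q'}$. 2. If $Q$ is of type II, then $\det C_Q=2\cdot 2^{t(Q')+t(Q'')}=2\cdot\det C_{Q'}\cdot\det C_{Q''}$. 3. If $Q$ is of type III, then $\det C_Q=3\cdot 2^{t(Q')+t(Q'')}=3\cdot\det C_{Q'}\cdot\det C_{Q''}$. 4. If $Q$ is of type IV with central cycle of length $m\ge 3$, then $$\det C_Q=(m+c(Q)-1)\prod_{j=1}^r 2^{t(Q^{(j)})}=(m+c(Q)-1)\prod_{j=1}^r\det C_{Q^{(j)}}.$$ -/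

import Mathlib

open scoped MulOpposite

noncomputable section

namespace ClusterTilted

/-! ### Quivers and mutation -/

/-- A finite quiver: finite sets of vertices and arrows, with source and target maps. -/
structure FinQuiver : Type 1 where
  V : Type
  E : Type
  fintypeV : Fintype V
  decEqV : DecidableEq V
  fintypeE : Fintype E
  decEqE : DecidableEq E
  src : E → V
  tgt : E → V

attribute [instance] FinQuiver.fintypeV FinQuiver.decEqV FinQuiver.fintypeE FinQuiver.decEqE

/-- The skew-symmetric matrix of a quiver: the entry at `(i, j)` is the number of arrows `i → j`
minus the number of arrows `j → i`. A quiver without loops and oriented 2-cycles is determined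
by it. -/
def FinQuiver.exchangeMatrix (Q : FinQuiver) : Matrix Q.V Q.V ℤ := fun i j =>
  ((Finset.univ.filter fun a : Q.E => Q.src a = i ∧ Q.tgt a = j).card : ℤ) -
    ((Finset.univ.filter fun a : Q.E => Q.src a = j ∧ Q.tgt a = i).card : ℤ)

/-- Fomin–Zelevinsky mutation at the vertex `k`: reverse all arrows at `k`; for other pairs of
vertices add an arrow `i → j` for every path `i → k → j` and cancel oriented 2-cycles. -/
def mutate {ι : Type*} [DecidableEq ι] (k : ι) (B : Matrix ι ι ℤ) : Matrix ι ι ℤ := fun i j =>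
  if i = k ∨ j = k then - B i j
  else B i j + max (B i k) 0 * max (B k j) 0 - max (B j k) 0 * max (B k i) 0

/-- `B'` is obtained from `B` by a finite sequence of mutations. -/
def MutationEquivalent {ι : Type*} [DecidableEq ι] (B B' : Matrix ι ι ℤ) : Prop :=
  Relation.ReflTransGen (fun C C' => ∃ k, C' = mutate k C) B B'

/-- The matrix of the quiver `• → • → ⋯ → •` with `n` vertices. -/
def matrixA (n : ℕ) : Matrix (Fin n) (Fin n) ℤ := fun i j =>
  if (i : ℕ) + 1 = j then 1 else if (j : ℕ) + 1 = i then -1 else 0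

/-- `Q` is a quiver (without loops and oriented 2-cycles) mutation equivalent to `A_n` for
some `n ≥ 1`. -/
def FinQuiver.IsTypeA (Q : FinQuiver) : Prop :=
  (∀ a : Q.E, Q.src a ≠ Q.tgt a) ∧
  (∀ a b : Q.E, ¬ (Q.tgt a = Q.src b ∧ Q.tgt b = Q.src a)) ∧
  ∃ (n : ℕ) (e : Fin n ≃ Q.V), 1 ≤ n ∧
    MutationEquivalent (matrixA n) (Q.exchangeMatrix.submatrix e e)

/-- The arrows `a`, `b`, `c` form, in this order, an oriented 3-cycle. -/
def FinQuiver.IsTriangle (Q : FinQuiver) (a b c : Q.E) : Prop :=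
  Q.tgt a = Q.src b ∧ Q.tgt b = Q.src c ∧ Q.tgt c = Q.src a

/-- The number `t(Q)` of triangles (oriented 3-cycles, regarded up to rotation) of a quiver
without loops. -/
def FinQuiver.triangles (Q : FinQuiver) : ℕ :=
  Set.ncard {T : Finset Q.E | ∃ a b c, Q.IsTriangle a b c ∧ T = {a, b, c}}

/-- The condition on the neighborhood of the root `v` in a quiver of type `A` with at least two
vertices: it is one of `• → v`, `v → •`, or an oriented triangle through `v`. -/
def FinQuiver.IsRoot (Q : FinQuiver) (v : Q.V) : Prop :=
  (∃ w : Q.V, w ≠ v) →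
    (∃! a : Q.E, Q.src a = v ∨ Q.tgt a = v) ∨
    (∃ a b c : Q.E, Q.IsTriangle a b c ∧ Q.src a = v ∧
      ∀ x : Q.E, Q.src x = v ∨ Q.tgt x = v → x = a ∨ x = c)

/-- A rooted quiver of type `A`. -/
structure RootedTypeA : Type 1 extends FinQuiver where
  root : V
  isTypeA : toFinQuiver.IsTypeA
  isRoot : toFinQuiver.IsRoot root

/-! ### Quivers with relations, their algebras and Cartan matrices -/

/-- A quiver with zero relations `p = 0` and commutativity relations `p = q`; a path is the list
of its arrows, in the order in which they are traversed. -/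
structure BoundQuiver : Type 1 extends FinQuiver where
  zeroRel : Set (List E)
  commRel : Set (List E × List E)

variable (K : Type*) [Field K]

/-- The defining relations of the algebra `KQ/I` on the generators `e_v` (`v` a vertex) and
the arrows: the relations of the path algebra (products of arrows are written in the order of
traversal), followed by those generating `I`. -/
inductive BoundQuiver.Rel (Q : BoundQuiver) :
    FreeAlgebra K (Q.V ⊕ Q.E) → FreeAlgebra K (Q.V ⊕ Q.E) → Prop
  | idem (v : Q.V) :
      Rel Q (FreeAlgebra.ι K (Sum.inl v) * FreeAlgebra.ι K (Sum.inl v))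
        (FreeAlgebra.ι K (Sum.inl v))
  | orth (v w : Q.V) (h : v ≠ w) :
      Rel Q (FreeAlgebra.ι K (Sum.inl v) * FreeAlgebra.ι K (Sum.inl w)) 0
  | unit : Rel Q (∑ v : Q.V, FreeAlgebra.ι K (Sum.inl v)) 1
  | source (a : Q.E) :
      Rel Q (FreeAlgebra.ι K (Sum.inl (Q.src a)) * FreeAlgebra.ι K (Sum.inr a))
        (FreeAlgebra.ι K (Sum.inr a))
  | target (a : Q.E) :
      Rel Q (FreeAlgebra.ι K (Sum.inr a) * FreeAlgebra.ι K (Sum.inl (Q.tgt a)))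
        (FreeAlgebra.ι K (Sum.inr a))
  | zero (p : List Q.E) (h : p ∈ Q.zeroRel) :
      Rel Q (p.map fun a => FreeAlgebra.ι K (Sum.inr a)).prod 0
  | comm (p q : List Q.E) (h : (p, q) ∈ Q.commRel) :
      Rel Q (p.map fun a => FreeAlgebra.ι K (Sum.inr a)).prod
        (q.map fun a => FreeAlgebra.ι K (Sum.inr a)).prod

/-- The algebra `KQ/I` of a quiver with relations. -/
abbrev BoundQuiver.Alg (Q : BoundQuiver) : Type _ := RingQuot (Q.Rel K)

/-- The idempotent `e_v` of the vertex `v`. -/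
def BoundQuiver.idempotent (Q : BoundQuiver) (v : Q.V) : Q.Alg K :=
  RingQuot.mkAlgHom K (Q.Rel K) (FreeAlgebra.ι K (Sum.inl v))

/-- The indecomposable projective right module `P_v = e_v A`. -/
abbrev BoundQuiver.proj (Q : BoundQuiver) (v : Q.V) : Submodule (Q.Alg K)ᵐᵒᵖ (Q.Alg K) :=
  Submodule.span (Q.Alg K)ᵐᵒᵖ {Q.idempotent K v}

/-- The Cartan matrix, with entries `dim_K Hom(P_j, P_i)`. -/
def BoundQuiver.cartan (Q : BoundQuiver) : Matrix Q.V Q.V ℤ := fun i j =>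
  (Module.finrank K (Q.proj K j →ₗ[(Q.Alg K)ᵐᵒᵖ] Q.proj K i) : ℤ)

/-! ### Cluster-tilted algebras of types `A` and `D` -/

/-- The quiver with relations of the cluster-tilted algebra of a quiver mutation equivalent to
`A_n`: the product of any two consecutive arrows of a triangle vanishes. -/
def RootedTypeA.bound (Q : RootedTypeA) : BoundQuiver where
  toFinQuiver := Q.toFinQuiver
  zeroRel := {p | ∃ a b c, Q.IsTriangle a b c ∧ p = [a, b]}
  commRel := ∅

section Gluing

variable (S : BoundQuiver) {J : Type} [Fintype J] [DecidableEq J]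
  (c : J → S.V) (Q : J → RootedTypeA)

/-- The vertices of a gluing: those of the skeleton and the non-root vertices of the pieces. -/
abbrev GlueVertex : Type := S.V ⊕ (Σ j, {x : (Q j).V // x ≠ (Q j).root})

/-- The map from the vertices of the `j`-th piece; it sends the root to `c j`. -/
def glueMap (j : J) (x : (Q j).V) : GlueVertex S Q :=
  if h : x = (Q j).root then Sum.inl (c j) else Sum.inr ⟨j, x, h⟩

/-- The gluing of the rooted quivers `Q j` of type `A` to the skeleton `S` at the (distinct)
vertices `c j`, with the union of all the relations. -/
def glue : BoundQuiver where
  V := GlueVertex S Q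
  E := S.E ⊕ (Σ j, (Q j).E)
  fintypeV := inferInstance
  decEqV := inferInstance
  fintypeE := inferInstance
  decEqE := inferInstance
  src := Sum.elim (fun a => Sum.inl (S.src a)) (fun a => glueMap S c Q a.1 ((Q a.1).src a.2))
  tgt := Sum.elim (fun a => Sum.inl (S.tgt a)) (fun a => glueMap S c Q a.1 ((Q a.1).tgt a.2))
  zeroRel := {p | ∃ q ∈ S.zeroRel, p = q.map Sum.inl} ∪
    {p | ∃ j, ∃ q ∈ (Q j).bound.zeroRel, p = q.map fun a => Sum.inr ⟨j, a⟩}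
  commRel := {r | ∃ q ∈ S.commRel, r = (q.1.map Sum.inl, q.2.map Sum.inl)} ∪
    {r | ∃ j, ∃ q ∈ (Q j).bound.commRel,
      r = (q.1.map fun a => Sum.inr ⟨j, a⟩, q.2.map fun a => Sum.inr ⟨j, a⟩)}

end Gluing

/-- A skeleton with vertex set `Fin n` and arrow set `Fin k`. -/
def mkSkeleton (n k : ℕ) (src tgt : Fin k → Fin n) (zeroRel : Set (List (Fin k)))
    (commRel : Set (List (Fin k) × List (Fin k))) : BoundQuiver where
  V := Fin n
  E := Fin k
  fintypeV := inferInstance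
  decEqV := inferInstance
  fintypeE := inferInstance
  decEqE := inferInstance
  src := src
  tgt := tgt
  zeroRel := zeroRel
  commRel := commRel

/-- The three skeleta of type I, with vertices `a = 0`, `b = 1`, `c = 2`: they are
`a → c → b`, `a → c ← b` and `a ← c → b`. -/
def skeletonI (k : Fin 3) : BoundQuiver :=
  mkSkeleton 3 2 (![![0, 2], ![0, 1], ![2, 2]] k) (![![2, 1], ![2, 2], ![0, 1]] k) ∅ ∅

/-- Type I: a rooted quiver of type `A` glued to one of the three skeleta at `c`. -/
def typeI (k : Fin 3) (Q' : RootedTypeA) : BoundQuiver :=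
  glue (skeletonI k) (J := Fin 1) (fun _ => (2 : Fin 3)) (fun _ => Q')

/-- The skeleton of type II. The vertices are `a = 0`, `b = 1`, `c' = 2`, `c'' = 3`; the arrows
are `α = 0 : c' → b`, `β = 1 : b → c''`, `γ = 2 : c' → a`, `δ = 3 : a → c''` and
`ε = 4 : c'' → c'`. The relations are `αβ = γδ` and `εα = εγ = βε = δε = 0`. -/
def skeletonII : BoundQuiver :=
  mkSkeleton 4 5 ![2, 1, 2, 0, 3] ![1, 3, 0, 3, 2]
    {[4, 0], [4, 2], [1, 4], [3, 4]} {([0, 1], [2, 3])}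

/-- Type II: two rooted quivers of type `A` glued at `c'` and `c''`. -/
def typeII (Q' Q'' : RootedTypeA) : BoundQuiver :=
  glue skeletonII (J := Fin 2) (![2, 3] : Fin 2 → Fin 4) ![Q', Q'']

/-- The skeleton of type III. The vertices are `a = 0`, `b = 1`, `c' = 2`, `c'' = 3`; the arrows
are `α = 0 : c' → b`, `β = 1 : b → c''`, `γ = 2 : c'' → a` and `δ = 3 : a → c'`.
The relations are `αβγ = βγδ = γδα = δαβ = 0`. -/
def skeletonIII : BoundQuiver :=
  mkSkeleton 4 4 ![2, 1, 3, 0] ![1, 3, 0, 2]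
    {[0, 1, 2], [1, 2, 3], [2, 3, 0], [3, 0, 1]} ∅

/-- Type III: two rooted quivers of type `A` glued at `c'` and `c''`. -/
def typeIII (Q' Q'' : RootedTypeA) : BoundQuiver :=
  glue skeletonIII (J := Fin 2) (![2, 3] : Fin 2 → Fin 4) ![Q', Q'']

section TypeIV

variable (m : ℕ) [NeZero m] (I : Finset (ZMod m))

/-- The arrows of the skeleton of type IV with central cycle `ℤ/m` and spikes at `I`. -/
abbrev ArrowIV : Type := ZMod m ⊕ (I ⊕ I)

/-- The arrow `i → i + 1` of the central cycle. -/
abbrev ArrowIV.cyc (i : ZMod m) : ArrowIV m I := Sum.inl i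

/-- The arrow `c_i → i` of the spike at `i ∈ I`. -/
abbrev ArrowIV.back (i : I) : ArrowIV m I := Sum.inr (Sum.inl i)

/-- The arrow `i + 1 → c_i` of the spike at `i ∈ I`. -/
abbrev ArrowIV.out (i : I) : ArrowIV m I := Sum.inr (Sum.inr i)

/-- The path `i + 1, i + 2, …, i` of length `m - 1` along the central cycle. -/
def longPath (i : ZMod m) : List (ArrowIV m I) :=
  (List.range (m - 1)).map fun k => ArrowIV.cyc m I (i + 1 + (k : ZMod m))

/-- The skeleton of type IV with central cycle `ℤ/m` and a spike `i → i + 1 → c_i → i` for every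
`i ∈ I`. -/
def skeletonIV : BoundQuiver where
  V := ZMod m ⊕ I
  E := ArrowIV m I
  fintypeV := inferInstance
  decEqV := inferInstance
  fintypeE := inferInstance
  decEqE := inferInstance
  src := Sum.elim (fun i => Sum.inl i)
    (Sum.elim (fun i => Sum.inr i) (fun i => Sum.inl (i.1 + 1)))
  tgt := Sum.elim (fun i => Sum.inl (i + 1))
    (Sum.elim (fun i => Sum.inl i.1) (fun i => Sum.inr i))
  zeroRel := {p | ∃ i : I, p = [ArrowIV.cyc m I i, ArrowIV.out m I i]} ∪
    {p | ∃ i : I, p = [ArrowIV.back m I i, ArrowIV.cyc m I i]} ∪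
    {p | ∃ i : ZMod m, i ∉ I ∧ p = longPath m I i}
  commRel := {r | ∃ i : I, r = ([ArrowIV.out m I i, ArrowIV.back m I i], longPath m I i)}

/-- Type IV: rooted quivers of type `A` glued to the skeleton at the vertices `c_i`, `i ∈ I`. -/
def typeIV (Q : I → RootedTypeA) : BoundQuiver :=
  glue (skeletonIV m I) (J := I) (fun i => (Sum.inr i : ZMod m ⊕ I)) Q

/-- The number `c(Q)` of vertices of the central cycle which are part of two spikes (the spike
at `i` contains the cycle vertices `i` and `i + 1`). -/
def sharedVertices : ℕ := (Finset.univ.filter fun v : ZMod m => v ∈ I ∧ v - 1 ∈ I).card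

end TypeIV

end ClusterTilted

end

/-! In all these algebras every space `e_x Λ e_y` has dimension at most one, so the Cartan matrix is
a 0/1 matrix recording which pairs of vertices are joined by a nonzero path. `ThinAt` is a
certificate for one row: representatives `g y` of the nonzero paths from `x`, and the arrows `F`
that prolong them. The relations reduce every path to a representative or to zero, which bounds the
dimension from above; matrix units on the arrows in `F` form a representation in which the
representatives survive, which bounds it from below. Hence `cartan_eq`.

Certificates are relative to a set `X` of arrows, so that quivers can be taken apart. If `X` and `Y`
meet only in a vertex `r` and no relation mixes them, a path changing sides passes through `r`, and
the determinant is multiplicative (`det_of_glue`, `HasThinDet.union`). Therefore a gluing has the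
determinant of its skeleton times those of its pieces (`hasThinDet_glue`).

For type `A`, quivers in the mutation class of `A_n` come from triangulations of a polygon:
diagonals are vertices, consecutive sides of a triangle give arrows, and mutation is a flip. With
triangulations encoded as plane binary trees, flips become tree rotations
(`exists_topMatrix_eq_mutate`). Such a quiver is a tree-like gluing of single arrows, of determinant
1, and oriented triangles, of determinant 2, which gives `2 ^ t` (`RootedTypeA.hasThinDet`).

The skeleta of types I, II, III are checked from finite tables. For type IV the nonzero paths are
determined by hand, and the Cartan matrix is written in blocks using a cyclic shift, the indicator
of the spikes and the all-ones matrix. Block elimination reduces it to a rank-one perturbation of a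
permutation matrix, whose determinant is `m + c(Q) - 1` (`det_extendedMatrix`). -/

namespace ClusterTilted

namespace BoundQuiver

/-! ### Paths modulo relations, and certificates for their nonzero classes -/

/-- The congruence on lists of arrows generated by the commutativity relations. -/
inductive PathEq (Q : BoundQuiver) : List Q.E → List Q.E → Prop
  | refl (p : List Q.E) : PathEq Q p p
  | symm {p q : List Q.E} : PathEq Q p q → PathEq Q q p
  | trans {p q r : List Q.E} : PathEq Q p q → PathEq Q q r → PathEq Q p r
  | comm (u v : List Q.E) {p q : List Q.E} (h : (p, q) ∈ Q.commRel) :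
      PathEq Q (u ++ p ++ v) (u ++ q ++ v)

/-- A list of arrows which contains a zero relation, up to commutativity relations. -/
def IsNull (Q : BoundQuiver) (p : List Q.E) : Prop :=
  ∃ u z v, z ∈ Q.zeroRel ∧ Q.PathEq p (u ++ z ++ v)

/-- `p` is a path from `x` to `y` all of whose arrows satisfy `F`. -/
def Walk (Q : BoundQuiver) (F : Q.E → Prop) : Q.V → List Q.E → Q.V → Prop
  | x, [], y => x = y
  | x, a :: p, y => Q.src a = x ∧ F a ∧ Walk Q F (Q.tgt a) p y

variable {Q : BoundQuiver}

lemma PathEq.append {p q : List Q.E} (h : Q.PathEq p q) (u v : List Q.E) :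
    Q.PathEq (u ++ p ++ v) (u ++ q ++ v) := by
  induction h with
  | refl p => exact .refl _
  | symm _ ih => exact ih.symm
  | trans _ _ ih₁ ih₂ => exact ih₁.trans ih₂
  | comm u' v' h => simpa [List.append_assoc] using PathEq.comm (u ++ u') (v' ++ v) h

lemma IsNull.append {p : List Q.E} (h : Q.IsNull p) (u v : List Q.E) :
    Q.IsNull (u ++ p ++ v) := by
  obtain ⟨u', z, v', hz, h⟩ := h
  exact ⟨u ++ u', z, v' ++ v, hz, by simpa [List.append_assoc] using h.append u v⟩

lemma IsNull.of_pathEq {p q : List Q.E} (h : Q.IsNull q) (e : Q.PathEq p q) : Q.IsNull p := by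
  obtain ⟨u, z, v, hz, h⟩ := h
  exact ⟨u, z, v, hz, e.trans h⟩

lemma IsNull.of_mem {z : List Q.E} (h : z ∈ Q.zeroRel) (u v : List Q.E) :
    Q.IsNull (u ++ z ++ v) := ⟨u, z, v, h, .refl _⟩

lemma Walk.mono {F G : Q.E → Prop} {p : List Q.E} (h : ∀ a ∈ p, F a → G a) {x y : Q.V}
    (w : Q.Walk F x p y) : Q.Walk G x p y := by
  induction p generalizing x with
  | nil => exact w
  | cons a p ih =>
    exact ⟨w.1, h a (by simp) w.2.1, ih (fun b hb => h b (by simp [hb])) w.2.2⟩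

lemma Walk.forall {F : Q.E → Prop} {p : List Q.E} {x y : Q.V} (w : Q.Walk F x p y) :
    ∀ a ∈ p, F a := by
  induction p generalizing x with
  | nil => simp
  | cons a p ih =>
    intro b hb
    rcases List.mem_cons.1 hb with rfl | hb
    · exact w.2.1
    · exact ih w.2.2 b hb

lemma Walk.append {F : Q.E → Prop} {p q : List Q.E} {x y z : Q.V} (w : Q.Walk F x p y)
    (w' : Q.Walk F y q z) : Q.Walk F x (p ++ q) z := by
  induction p generalizing x with
  | nil => cases w; exact w'
  | cons a p ih => exact ⟨w.1, w.2.1, ih w.2.2⟩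

lemma Walk.exists_last {F : Q.E → Prop} {p : List Q.E} {x y : Q.V} (w : Q.Walk F x p y)
    (h : x ≠ y) : ∃ a, F a ∧ Q.tgt a = y := by
  induction p generalizing x with
  | nil => exact absurd w h
  | cons a p ih =>
    by_cases e : Q.tgt a = y
    · exact ⟨a, w.2.1, e⟩
    · exact ih w.2.2 e

/-- A description of the nonzero paths starting at `x` and consisting of arrows in `X`: there is,
up to commutativity relations, one such path `g y` for every vertex `y` with `d y`, and `F a`
says that `g (src a)` followed by `a` is nonzero. -/
structure ThinAt (Q : BoundQuiver) (X : Set Q.E) (x : Q.V) where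
  F : Q.E → Prop
  d : Q.V → Prop
  g : Q.V → List Q.E
  d_self : d x
  g_self : g x = []
  mem_of_F {a : Q.E} : F a → a ∈ X
  d_src {a : Q.E} : F a → d (Q.src a)
  d_tgt {a : Q.E} : F a → d (Q.tgt a)
  tgt_ne {a : Q.E} : F a → Q.tgt a ≠ x
  pathEq {a : Q.E} : F a → Q.PathEq (g (Q.src a) ++ [a]) (g (Q.tgt a))
  isNull {a : Q.E} : a ∈ X → d (Q.src a) → ¬ F a → Q.IsNull (g (Q.src a) ++ [a])
  walk {y : Q.V} : d y → Q.Walk F x (g y) y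
  zero {p : List Q.E} : p ∈ Q.zeroRel → (∀ a ∈ p, a ∈ X) → ∀ y z, ¬ Q.Walk F y p z
  comm {p q : List Q.E} : (p, q) ∈ Q.commRel → (∀ a ∈ p, a ∈ X) → (∀ a ∈ q, a ∈ X) →
    ∀ y z, Q.Walk F y p z ↔ Q.Walk F y q z

/-! ### The Cartan matrix -/

section Algebra

variable (K : Type*) [Field K]

/-- The element of the algebra given by an arrow. -/
noncomputable def arr (Q : BoundQuiver) (a : Q.E) : Q.Alg K :=
  RingQuot.mkAlgHom K (Q.Rel K) (FreeAlgebra.ι K (Sum.inr a))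

/-- The product of a list of arrows. -/
noncomputable def path (Q : BoundQuiver) (p : List Q.E) : Q.Alg K := (p.map (Q.arr K)).prod

lemma path_eq_mk (p : List Q.E) : Q.path K p =
    RingQuot.mkAlgHom K (Q.Rel K) (p.map fun a => FreeAlgebra.ι K (Sum.inr a)).prod := by
  rw [map_list_prod, List.map_map]; rfl

@[simp] lemma path_nil : Q.path K [] = 1 := rfl

lemma path_append (p q : List Q.E) : Q.path K (p ++ q) = Q.path K p * Q.path K q := by
  simp [path]

@[simp] lemma path_singleton (a : Q.E) : Q.path K [a] = Q.arr K a := by simp [path]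

lemma idempotent_mul_self (v : Q.V) :
    Q.idempotent K v * Q.idempotent K v = Q.idempotent K v := by
  rw [idempotent, ← map_mul]; exact RingQuot.mkAlgHom_rel K (.idem v)

lemma idempotent_mul_of_ne {v w : Q.V} (h : v ≠ w) :
    Q.idempotent K v * Q.idempotent K w = 0 := by
  rw [idempotent, idempotent, ← map_mul, RingQuot.mkAlgHom_rel K (.orth v w h), map_zero]

lemma idempotent_src_mul_arr (a : Q.E) :
    Q.idempotent K (Q.src a) * Q.arr K a = Q.arr K a := by
  rw [idempotent, arr, ← map_mul]; exact RingQuot.mkAlgHom_rel K (.source a)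

lemma arr_mul_idempotent_tgt (a : Q.E) :
    Q.arr K a * Q.idempotent K (Q.tgt a) = Q.arr K a := by
  rw [idempotent, arr, ← map_mul]; exact RingQuot.mkAlgHom_rel K (.target a)

lemma PathEq.path_eq {p q : List Q.E} (h : Q.PathEq p q) : Q.path K p = Q.path K q := by
  induction h with
  | refl p => rfl
  | symm _ ih => exact ih.symm
  | trans _ _ ih₁ ih₂ => exact ih₁.trans ih₂
  | @comm u v p q h =>
    have : Q.path K p = Q.path K q := by
      rw [path_eq_mk, path_eq_mk]; exact RingQuot.mkAlgHom_rel K (.comm _ _ h)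
    simp only [path_append, this]

lemma IsNull.path_eq_zero {p : List Q.E} (h : Q.IsNull p) : Q.path K p = 0 := by
  obtain ⟨u, z, v, hz, h⟩ := h
  have : Q.path K z = 0 := by
    rw [path_eq_mk, RingQuot.mkAlgHom_rel K (.zero _ hz), map_zero]
  rw [h.path_eq K, path_append, path_append, this, mul_zero, zero_mul]

/-- The idempotent at the start is kept because the empty list is sent to `1`, which remembers no
vertex; only `e_x` times the product is the path itself. -/
lemma Walk.path_mul_idempotent {F : Q.E → Prop} {p : List Q.E} {x y : Q.V}
    (w : Q.Walk F x p y) :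
    Q.idempotent K x * Q.path K p * Q.idempotent K y = Q.idempotent K x * Q.path K p := by
  induction p generalizing x with
  | nil => cases w; simp [idempotent_mul_self]
  | cons a p ih =>
    have h := ih w.2.2
    have e : Q.path K (a :: p) =
        Q.arr K a * (Q.idempotent K (Q.tgt a) * Q.path K p) := by
      rw [← mul_assoc, arr_mul_idempotent_tgt]; simp [path]
    rw [e, mul_assoc, mul_assoc, h]

/-! ### Bounding `e_x Λ e_y` from below by a representation and from above by a spanning set -/

section Representation

variable {X : Set Q.E} {x : Q.V}

open Classical in
/-- The images of the generators in the representation given by the arrows satisfying `F`. -/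
noncomputable def repGen (Q : BoundQuiver) (F : Q.E → Prop) : Q.V ⊕ Q.E → Matrix Q.V Q.V K :=
  Sum.elim (fun v => Matrix.single v v 1)
    (fun a => if F a then Matrix.single (Q.src a) (Q.tgt a) 1 else 0)

-- Matrix units multiply to zero unless the arrows are composable, so `Walk` governs the product.
-- This turns the defining relations into the fields `zero` and `comm`.
open Classical in
lemma repGen_prod_apply (F : Q.E → Prop) (p : List Q.E) (y z : Q.V) :
    (p.map fun a => repGen K Q F (Sum.inr a)).prod y z = if Q.Walk F y p z then 1 else 0 := by
  induction p generalizing y with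
  | nil => simp only [Walk, List.map_nil, List.prod_nil, Matrix.one_apply]; congr
  | cons a p ih =>
    rw [List.map_cons, List.prod_cons]
    by_cases hF : F a
    · by_cases hy : Q.src a = y
      · subst hy
        simp only [repGen, Sum.elim_inr, hF, if_true, Walk, true_and]
        rw [Matrix.single_mul_apply_same, one_mul]
        exact ih _
      · simp only [repGen, Sum.elim_inr, hF, if_true, Walk, hy, false_and, if_false]
        rw [Matrix.single_mul_apply_of_ne _ _ _ _ _ (Ne.symm hy)]
    · simp [repGen, hF, Walk]

open Classical in
/-- The representation of the algebra on the nonzero paths starting at `x`. -/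
noncomputable def ThinAt.rep (P : ThinAt Q Set.univ x) : Q.Alg K →ₐ[K] Matrix Q.V Q.V K :=
  RingQuot.liftAlgHom K ⟨FreeAlgebra.lift K (repGen K Q P.F), by
    intro u v h
    induction h with
    | idem v => simp [repGen]
    | orth v w h => simp [repGen, Matrix.single_mul_single_of_ne, h]
    | unit =>
      simp only [map_sum, FreeAlgebra.lift_ι_apply, repGen, Sum.elim_inl, map_one]
      ext i j
      rw [Matrix.sum_apply]
      simp only [Matrix.single_apply, Matrix.one_apply]
      by_cases h : i = j
      · subst h; simp
      · rw [if_neg h]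
        refine Finset.sum_eq_zero fun v _ => if_neg ?_
        rintro ⟨rfl, rfl⟩; exact h rfl
    | source a => by_cases h : P.F a <;> simp [repGen, h]
    | target a => by_cases h : P.F a <;> simp [repGen, h]
    | zero p h =>
      rw [map_list_prod, List.map_map, map_zero]
      ext y z
      have := repGen_prod_apply K P.F p y z
      simp only [Function.comp_def, FreeAlgebra.lift_ι_apply]
      rw [this, if_neg (P.zero h (by simp) y z)]; rfl
    | comm p q h =>
      rw [map_list_prod, List.map_map, map_list_prod, List.map_map]
      ext y z
      have h₁ := repGen_prod_apply K P.F p y z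
      have h₂ := repGen_prod_apply K P.F q y z
      simp only [Function.comp_def, FreeAlgebra.lift_ι_apply]
      rw [h₁, h₂]
      simp only [P.comm h (by simp) (by simp) y z]⟩

/-- The representation sends the path to a matrix with entry 1 at `(x, y)`, so this entry recovers
the scalar. This is the lower bound on the dimension. -/
lemma ThinAt.smul_path_injective (P : ThinAt Q Set.univ x) {y : Q.V} (h : P.d y) :
    Function.Injective fun r : K => r • (Q.idempotent K x * Q.path K (P.g y)) := by
  classical
  intro r s hrs
  have h1 : P.rep K (Q.idempotent K x * Q.path K (P.g y)) x y = 1 := by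
    rw [map_mul, path_eq_mk, idempotent, rep, RingQuot.liftAlgHom_mkAlgHom_apply,
      RingQuot.liftAlgHom_mkAlgHom_apply, map_list_prod, List.map_map, FreeAlgebra.lift_ι_apply]
    have := repGen_prod_apply K P.F (P.g y) x y
    rw [if_pos (P.walk h)] at this
    simp only [Function.comp_def, FreeAlgebra.lift_ι_apply]
    rw [show repGen K Q P.F (Sum.inl x) = Matrix.single x x 1 from rfl,
      Matrix.single_mul_apply_same, one_mul]
    exact this
  have h2 := congrArg (fun u => P.rep K u x y) hrs
  simpa [h1, -map_mul] using h2

/-- The span of the nonzero paths starting at `x`. -/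
noncomputable def ThinAt.span (P : ThinAt Q Set.univ x) : Submodule K (Q.Alg K) :=
  Submodule.span K {u | ∃ y, P.d y ∧ u = Q.idempotent K x * Q.path K (P.g y)}

/-- It suffices to multiply a representative by a generator. A vertex keeps or kills it; an arrow in
`F` leads to the next representative by `pathEq`; any other arrow kills it, by `isNull` or by
orthogonality of idempotents. -/
lemma ThinAt.mul_mem_span (P : ThinAt Q Set.univ x) {u : Q.Alg K} (hu : u ∈ P.span K)
    (w : Q.Alg K) : u * w ∈ P.span K := by
  obtain ⟨w, rfl⟩ := RingQuot.mkAlgHom_surjective K (Q.Rel K) w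
  induction w using FreeAlgebra.induction generalizing u with
  | grade0 r =>
    rw [AlgHom.commutes, ← Algebra.commutes, ← Algebra.smul_def]
    exact Submodule.smul_mem _ _ hu
  | mul a b ha hb => rw [map_mul, ← mul_assoc]; exact hb (ha hu)
  | add a b ha hb => rw [map_add, mul_add]; exact Submodule.add_mem _ (ha hu) (hb hu)
  | grade1 s =>
    induction hu using Submodule.span_induction with
    | zero => rw [zero_mul]; exact Submodule.zero_mem _
    | add a b _ _ ha hb => rw [add_mul]; exact Submodule.add_mem _ ha hb
    | smul r a _ ha => rw [smul_mul_assoc]; exact Submodule.smul_mem _ _ ha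
    | mem u hu =>
      obtain ⟨y, hy, rfl⟩ := hu
      have hw := (P.walk hy).path_mul_idempotent K
      cases s with
      | inl v =>
        change _ * Q.idempotent K v ∈ _
        by_cases h : y = v
        · subst h; rw [hw]; exact Submodule.subset_span ⟨y, hy, rfl⟩
        · rw [← hw, mul_assoc, idempotent_mul_of_ne K h, mul_zero]; exact Submodule.zero_mem _
      | inr a =>
        change _ * Q.arr K a ∈ _
        by_cases h : y = Q.src a
        · subst h
          rw [mul_assoc, ← path_singleton, ← path_append]
          by_cases hF : P.F a
          · rw [(P.pathEq hF).path_eq K]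
            exact Submodule.subset_span ⟨_, P.d_tgt hF, rfl⟩
          · rw [(P.isNull (Set.mem_univ a) hy hF).path_eq_zero K, mul_zero]
            exact Submodule.zero_mem _
        · rw [← hw, ← idempotent_src_mul_arr, mul_assoc, ← mul_assoc (Q.idempotent K y),
            idempotent_mul_of_ne K h, zero_mul, mul_zero]
          exact Submodule.zero_mem _

lemma ThinAt.idempotent_mul_mem_span (P : ThinAt Q Set.univ x) (w : Q.Alg K) :
    Q.idempotent K x * w ∈ P.span K :=
  P.mul_mem_span K (Submodule.subset_span ⟨x, P.d_self, by rw [P.g_self]; simp⟩) w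

/-- Multiplying the spanning paths by `e_y` leaves only the one ending at `y`. This is the upper
bound on the dimension. -/
lemma ThinAt.idempotent_mul_mul_idempotent (P : ThinAt Q Set.univ x) (w : Q.Alg K) (y : Q.V) :
    (P.d y → ∃ r : K, Q.idempotent K x * w * Q.idempotent K y =
      r • (Q.idempotent K x * Q.path K (P.g y))) ∧
    (¬ P.d y → Q.idempotent K x * w * Q.idempotent K y = 0) := by
  have h := P.idempotent_mul_mem_span K w
  generalize Q.idempotent K x * w = t at h ⊢
  induction h using Submodule.span_induction with
  | zero => exact ⟨fun _ => ⟨0, by simp⟩, fun _ => by simp⟩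
  | add a b _ _ ha hb =>
    refine ⟨fun h => ?_, fun h => ?_⟩
    · obtain ⟨r, hr⟩ := ha.1 h
      obtain ⟨s, hs⟩ := hb.1 h
      exact ⟨r + s, by rw [add_mul, hr, hs, add_smul]⟩
    · rw [add_mul, ha.2 h, hb.2 h, add_zero]
  | smul c a _ ha =>
    refine ⟨fun h => ?_, fun h => ?_⟩
    · obtain ⟨r, hr⟩ := ha.1 h
      exact ⟨c * r, by rw [smul_mul_assoc, hr, mul_smul]⟩
    · rw [smul_mul_assoc, ha.2 h, smul_zero]
  | mem u hu =>
    obtain ⟨z, hz, rfl⟩ := hu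
    have hw := (P.walk hz).path_mul_idempotent K
    by_cases e : z = y
    · subst e
      exact ⟨fun _ => ⟨1, by rw [hw, one_smul]⟩, fun h => absurd hz h⟩
    · have : Q.idempotent K x * Q.path K (P.g z) * Q.idempotent K y = 0 := by
        rw [← hw, mul_assoc, idempotent_mul_of_ne K e, mul_zero]
      exact ⟨fun _ => ⟨0, by rw [this, zero_smul]⟩, fun _ => this⟩

end Representation

/-! ### Homomorphisms between projectives -/

lemma mem_proj_iff {v : Q.V} {u : Q.Alg K} : u ∈ Q.proj K v ↔ Q.idempotent K v * u = u := by
  rw [proj, Submodule.mem_span_singleton]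
  constructor
  · rintro ⟨w, rfl⟩
    rw [MulOpposite.smul_eq_mul_unop, ← mul_assoc, idempotent_mul_self]
  · intro h
    exact ⟨MulOpposite.op u, by rw [MulOpposite.smul_eq_mul_unop]; exact h⟩

lemma idempotent_mem_proj (v : Q.V) : Q.idempotent K v ∈ Q.proj K v :=
  Submodule.mem_span_singleton_self _

/-- Since `u = e_j u`, the image of the generator determines `f`, which is left multiplication by
it. Thus `Hom(P_j, P_i)` is identified with `e_i Λ e_j`. -/
lemma hom_apply {i j : Q.V} (f : Q.proj K j →ₗ[(Q.Alg K)ᵐᵒᵖ] Q.proj K i) (u : Q.proj K j) :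
    (f u : Q.Alg K) = f ⟨Q.idempotent K j, idempotent_mem_proj K j⟩ * (u : Q.Alg K) := by
  have h := (mem_proj_iff K).1 u.2
  have : u = MulOpposite.op (u : Q.Alg K) •
      (⟨Q.idempotent K j, idempotent_mem_proj K j⟩ : Q.proj K j) := by
    ext; simp [h]
  conv_lhs => rw [this, map_smul]
  simp

/-- Left multiplication by an element of `e_i Λ e_j`. -/
noncomputable def homOfElem {i j : Q.V} (z : Q.Alg K) (hz : Q.idempotent K i * z = z) :
    Q.proj K j →ₗ[(Q.Alg K)ᵐᵒᵖ] Q.proj K i where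
  toFun u := ⟨z * u, (mem_proj_iff K).2 (by rw [← mul_assoc, hz])⟩
  map_add' u v := by ext; simp [mul_add]
  map_smul' r u := by ext; simp [mul_assoc]

theorem finrank_hom {i j : Q.V} (P : ThinAt Q Set.univ i) [Decidable (P.d j)] :
    Module.finrank K (Q.proj K j →ₗ[(Q.Alg K)ᵐᵒᵖ] Q.proj K i) = if P.d j then 1 else 0 := by
  have key (f : Q.proj K j →ₗ[(Q.Alg K)ᵐᵒᵖ] Q.proj K i) :
      (f ⟨Q.idempotent K j, idempotent_mem_proj K j⟩ : Q.Alg K) =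
        Q.idempotent K i * f ⟨Q.idempotent K j, idempotent_mem_proj K j⟩ * Q.idempotent K j := by
    rw [(mem_proj_iff K).1 (f _).2]
    exact hom_apply K f ⟨_, idempotent_mem_proj K j⟩
  split_ifs with h
  · have hz : Q.idempotent K i * (Q.idempotent K i * Q.path K (P.g j)) =
        Q.idempotent K i * Q.path K (P.g j) := by rw [← mul_assoc, idempotent_mul_self]
    have hw := (P.walk h).path_mul_idempotent K
    let e : K →ₗ[K] (Q.proj K j →ₗ[(Q.Alg K)ᵐᵒᵖ] Q.proj K i) :=
      LinearMap.toSpanSingleton K _ (homOfElem K _ hz)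
    have he : Function.Bijective e := by
      refine ⟨fun r s hrs => P.smul_path_injective K h ?_, fun f => ?_⟩
      · have := congrArg (fun f => (f ⟨Q.idempotent K j, idempotent_mem_proj K j⟩ : Q.Alg K)) hrs
        simpa [e, homOfElem, hw] using this
      · obtain ⟨r, hr⟩ := (P.idempotent_mul_mul_idempotent K
          (f ⟨Q.idempotent K j, idempotent_mem_proj K j⟩) j).1 h
        refine ⟨r, ?_⟩
        ext u
        rw [hom_apply K f, key f, hr]
        simp [homOfElem, e]
    rw [← (LinearEquiv.ofBijective e he).finrank_eq, Module.finrank_self]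
  · have : Subsingleton (Q.proj K j →ₗ[(Q.Alg K)ᵐᵒᵖ] Q.proj K i) := by
      refine subsingleton_of_forall_eq 0 fun f => ?_
      ext u
      rw [hom_apply, key, (P.idempotent_mul_mul_idempotent K _ j).2 h]
      simp
    exact Module.finrank_zero_of_subsingleton

open Classical in
/-- The matrix of the relation `d`: the candidate for the Cartan matrix. -/
noncomputable def thinMatrix {X : Set Q.E} (P : ∀ x, ThinAt Q X x) : Matrix Q.V Q.V ℤ :=
  fun x y => if (P x).d y then 1 else 0

theorem cartan_eq (P : ∀ x, ThinAt Q Set.univ x) : Q.cartan K = thinMatrix P := by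
  classical
  ext i j
  rw [cartan, finrank_hom K (P i), thinMatrix]
  push_cast
  rfl

end Algebra

end BoundQuiver

/-! ### Determinants -/

/-- The matrix is block triangular with an identity block outside the range. This discards vertices
that no arrow under consideration touches. -/
lemma det_eq_det_submatrix {α β : Type*} [Fintype α] [DecidableEq α] [Fintype β] [DecidableEq β]
    {f : α → β} (hf : Function.Injective f) (N : Matrix β β ℤ)
    (h : ∀ x y, (x ∉ Set.range f ∨ y ∉ Set.range f) → N x y = if x = y then 1 else 0) :
    N.det = (N.submatrix f f).det := by
  classical
  rw [Matrix.twoBlockTriangular_det N (· ∈ Set.range f)]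
  · have h1 : N.toSquareBlockProp (fun x => ¬ x ∈ Set.range f) = 1 := by
      ext x y
      simp [Matrix.toSquareBlockProp_def, h x.1 y.1 (Or.inl x.2), Matrix.one_apply, Subtype.ext_iff]
    rw [h1, Matrix.det_one, mul_one]
    refine Eq.trans ?_ (Matrix.det_submatrix_equiv_self (Equiv.ofInjective f hf)
      (N.toSquareBlockProp (· ∈ Set.range f))).symm
    congr!
  · intro i hi j hj
    rw [h i j (Or.inl hi), if_neg]
    rintro rfl
    exact hi hj

/-- Here `A` and `C` are the matrices of the two sides, `r` is the common vertex and `B` marks the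
vertices strictly on the side of `C`. Entries of `M` between the sides factor through `r`, so
clearing them with row `r` leaves a product involving `A` and `C`. -/
lemma det_of_glue {V : Type*} [Fintype V] [DecidableEq V] (B : V → Prop) [DecidablePred B] {r : V}
    (hr : ¬ B r) (M A C : Matrix V V ℤ) (hAr : A r r = 1) (hCr : C r r = 1)
    (hA : ∀ x y, (B x ∨ B y) → A x y = if x = y then 1 else 0)
    (hC : ∀ x y, (¬ B x ∧ x ≠ r ∨ ¬ B y ∧ y ≠ r) → C x y = if x = y then 1 else 0)
    (hM : ∀ x y, M x y = if B x then (if B y then C x y else C x r * A r y) else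
      (if B y then A x r * C r y else A x y)) : M.det = A.det * C.det := by
  -- `L` subtracts `C x r` times row `r` from each row `x` in `B`. Its determinant is 1 because `r`
  -- is not in `B`.
  let u : V → ℤ := fun x => if B x then - C x r else 0
  let v : V → ℤ := Pi.single r 1
  let L : Matrix V V ℤ := 1 + Matrix.replicateCol Unit u * Matrix.replicateRow Unit v
  have hL : L.det = 1 := by
    rw [Matrix.det_one_add_replicateCol_mul_replicateRow]
    simp [u, v, hr]
  have hmul (N : Matrix V V ℤ) (x y : V) : (L * N) x y = N x y + u x * N r y := by
    simp only [L, add_mul, one_mul, Matrix.add_apply, Matrix.mul_assoc]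
    congr 1
    rw [Matrix.mul_apply]
    simp [Matrix.mul_apply, v, Pi.single_apply]
  have key : L * M = A * (L * C) := by
    ext x y
    rw [hmul, Matrix.mul_apply]
    simp only [hmul]
    have hAB {x z : V} (hx : ¬ B x) (hz : B z) : A x z = 0 := by
      rw [hA x z (Or.inr hz), if_neg]
      rintro rfl
      exact hx hz
    by_cases hx : B x
    · rw [Finset.sum_eq_single x, hA x x (Or.inl hx), if_pos rfl, one_mul]
      · have hu : u x = - C x r := if_pos hx
        rw [hu]
        by_cases hy : B y
        · rw [hM, hM, if_pos hx, if_pos hy, if_neg hr, if_pos hy, hAr, one_mul]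
        · rw [hM, hM, if_pos hx, if_neg hy, if_neg hr, if_neg hy]
          by_cases hyr : y = r
          · subst hyr; rw [hAr, hCr]; ring
          · rw [hC x y (Or.inr ⟨hy, hyr⟩), hC r y (Or.inr ⟨hy, hyr⟩), if_neg, if_neg (Ne.symm hyr)]
            · ring
            · rintro rfl; exact hy hx
      · intro z _ hz
        rw [hA x z (Or.inl hx), if_neg (Ne.symm hz), zero_mul]
      · simp
    · have hu : u x = 0 := if_neg hx
      rw [hu, zero_mul, add_zero, hM, if_neg hx]
      by_cases hy : B y
      · rw [if_pos hy, Finset.sum_eq_single r]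
        · rw [show u r = 0 from if_neg hr, zero_mul, add_zero]
        · intro z _ hz
          by_cases hBz : B z
          · rw [hAB hx hBz, zero_mul]
          · rw [hC z y (Or.inl ⟨hBz, hz⟩), if_neg, show u z = 0 from if_neg hBz, zero_mul, add_zero,
              mul_zero]
            rintro rfl; exact hBz hy
        · simp
      · rw [if_neg hy, Finset.sum_eq_single y]
        · have : C y y = 1 := by
            by_cases hyr : y = r
            · rw [hyr, hCr]
            · rw [hC y y (Or.inl ⟨hy, hyr⟩), if_pos rfl]
          rw [show u y = 0 from if_neg hy, this, zero_mul, add_zero, mul_one]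
        · intro z _ hz
          by_cases hBz : B z
          · rw [hAB hx hBz, zero_mul]
          · rw [show u z = 0 from if_neg hBz, zero_mul, add_zero, hC z y, if_neg hz, mul_zero]
            by_cases hyr : y = r
            · exact Or.inl ⟨hBz, hyr ▸ hz⟩
            · exact Or.inr ⟨hy, hyr⟩
        · simp
  have := congrArg Matrix.det key
  rwa [Matrix.det_mul, Matrix.det_mul, Matrix.det_mul, hL, one_mul, one_mul] at this

/-! ### Joining certificates along a vertex -/

namespace BoundQuiver

variable {Q : BoundQuiver} {X Y Z : Set Q.E}

lemma walk_congr {F G : Q.E → Prop} {p : List Q.E} (h : ∀ a ∈ p, F a ↔ G a) {y z : Q.V} :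
    Q.Walk F y p z ↔ Q.Walk G y p z :=
  ⟨fun w => w.mono fun a ha => (h a ha).1, fun w => w.mono fun a ha => (h a ha).2⟩

/-- The vertex `v` is an endpoint of an arrow in `X`. -/
def Touches (Q : BoundQuiver) (X : Set Q.E) (v : Q.V) : Prop :=
  ∃ a ∈ X, Q.src a = v ∨ Q.tgt a = v

lemma touches_src {a : Q.E} (h : a ∈ X) : Q.Touches X (Q.src a) := ⟨a, h, Or.inl rfl⟩

lemma touches_tgt {a : Q.E} (h : a ∈ X) : Q.Touches X (Q.tgt a) := ⟨a, h, Or.inr rfl⟩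

lemma Touches.union {v : Q.V} (h : Q.Touches (X ∪ Y) v) : Q.Touches X v ∨ Q.Touches Y v := by
  obtain ⟨a, ha | ha, h⟩ := h
  · exact Or.inl ⟨a, ha, h⟩
  · exact Or.inr ⟨a, ha, h⟩

namespace ThinAt

lemma eq_or_touches {x y : Q.V} (P : ThinAt Q X x) (h : P.d y) : y = x ∨ Q.Touches X y := by
  by_cases e : x = y
  · exact Or.inl e.symm
  · obtain ⟨a, ha, rfl⟩ := (P.walk h).exists_last e
    exact Or.inr (touches_tgt (P.mem_of_F ha))

lemma eq_or_touches_left {x y : Q.V} (P : ThinAt Q X x) (h : P.d y) : y = x ∨ Q.Touches X x := by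
  have hw := P.walk h
  cases e : P.g y with
  | nil => rw [e] at hw; exact Or.inl hw.symm
  | cons a p =>
    rw [e] at hw
    exact Or.inr (hw.1 ▸ touches_src (P.mem_of_F hw.2.1))

/-- The trivial description at a vertex which is not an endpoint of an arrow in `X`. -/
def trivial {x : Q.V} (hx : ¬ Q.Touches X x)
    (hz : ∀ p ∈ Q.zeroRel, (∀ a ∈ p, a ∈ X) → p ≠ [])
    (hc : ∀ p q, (p, q) ∈ Q.commRel → (∀ a ∈ p, a ∈ X) → (∀ a ∈ q, a ∈ X) → p ≠ [] ∧ q ≠ []) :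
    ThinAt Q X x where
  F _ := False
  d y := y = x
  g _ := []
  d_self := rfl
  g_self := rfl
  mem_of_F h := h.elim
  d_src h := h.elim
  d_tgt h := h.elim
  tgt_ne h := h.elim
  pathEq h := h.elim
  isNull h e := absurd (touches_src h) (e ▸ hx)
  walk h := h.symm
  zero {p} h hX y z w := by
    cases p with
    | nil => exact hz _ h hX rfl
    | cons a p => exact w.2.1
  comm {p q} h hp hq y z := by
    cases p with
    | nil => exact absurd rfl (hc _ _ h hp hq).1
    | cons a p =>
      cases q with
      | nil => exact absurd rfl (hc _ _ h hp hq).2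
      | cons b q => exact ⟨fun w => w.2.1.elim, fun w => w.2.1.elim⟩

end ThinAt

/-- The sets of arrows `X` and `Y` meet at most at the vertex `r`, and every relation involving
only arrows from `X ∪ Y` is a relation on `X` or on `Y`. -/
structure Separated (Q : BoundQuiver) (X Y : Set Q.E) (r : Q.V) : Prop where
  disjoint : ∀ a, a ∈ X → a ∉ Y
  eq_of_touches : ∀ v, Q.Touches X v → Q.Touches Y v → v = r
  zero : ∀ p ∈ Q.zeroRel, (∀ a ∈ p, a ∈ X ∪ Y) → (∀ a ∈ p, a ∈ X) ∨ (∀ a ∈ p, a ∈ Y)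
  comm : ∀ p q, (p, q) ∈ Q.commRel → (∀ a ∈ p, a ∈ X ∪ Y) → (∀ a ∈ q, a ∈ X ∪ Y) →
    ((∀ a ∈ p, a ∈ X) ∧ (∀ a ∈ q, a ∈ X)) ∨ ((∀ a ∈ p, a ∈ Y) ∧ (∀ a ∈ q, a ∈ Y))

lemma Separated.symm {r : Q.V} (h : Q.Separated X Y r) : Q.Separated Y X r where
  disjoint a ha ha' := h.disjoint a ha' ha
  eq_of_touches v hY hX := h.eq_of_touches v hX hY
  zero p hp hX := (h.zero p hp (by rwa [Set.union_comm])).symm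
  comm p q hp hX hX' := (h.comm p q hp (by rwa [Set.union_comm]) (by rwa [Set.union_comm])).symm

namespace ThinAt

section Glue

variable {x r : Q.V} (P : ThinAt Q X x) (R : ThinAt Q Y r) (h : Q.Separated X Y r)
  (hx : Q.Touches Y x → x = r)

-- Ends of paths touch their own set of arrows or are the starting vertex, so both sides can only
-- reach the gluing vertex. This reconciles the two branches of `g` in `glue`.
include h hx in
lemma eq_of_d_of_d {y : Q.V} (hP : P.d y) (hR : R.d y) : y = r := by
  rcases R.eq_or_touches hR with e | hR
  · exact e
  · rcases P.eq_or_touches hP with rfl | hP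
    · exact hx hR
    · exact h.eq_of_touches _ hP hR

open Classical in
/-- The paths from `x` in the union of two sets of arrows meeting at `r`. -/
noncomputable def glue (hZ : Z = X ∪ Y) : ThinAt Q Z x := by
  have hF {a : Q.E} : (P.F a ∨ P.d r ∧ R.F a) → a ∈ X → P.F a := fun hF ha =>
    hF.resolve_right fun h' => h.disjoint a ha (R.mem_of_F h'.2)
  have hF' {a : Q.E} : (P.F a ∨ P.d r ∧ R.F a) → a ∈ Y → P.d r ∧ R.F a := fun hF ha =>
    hF.resolve_left fun h' => h.disjoint a (P.mem_of_F h') ha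
  have hgR {y : Q.V} (hr : P.d r) (hy : R.d y) :
      (if P.d y then P.g y else P.g r ++ R.g y) = P.g r ++ R.g y := by
    split_ifs with hP
    · rw [P.eq_of_d_of_d R h hx hP hy, R.g_self, List.append_nil]
    · rfl
  exact
  { F a := P.F a ∨ P.d r ∧ R.F a
    d y := P.d y ∨ P.d r ∧ R.d y
    g y := if P.d y then P.g y else P.g r ++ R.g y
    d_self := Or.inl P.d_self
    g_self := by rw [if_pos P.d_self, P.g_self]
    mem_of_F := by
      rintro a (ha | ⟨_, ha⟩)
      · exact hZ ▸ Or.inl (P.mem_of_F ha)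
      · exact hZ ▸ Or.inr (R.mem_of_F ha)
    d_src := by
      rintro a (ha | ⟨hr, ha⟩)
      · exact Or.inl (P.d_src ha)
      · exact Or.inr ⟨hr, R.d_src ha⟩
    d_tgt := by
      rintro a (ha | ⟨hr, ha⟩)
      · exact Or.inl (P.d_tgt ha)
      · exact Or.inr ⟨hr, R.d_tgt ha⟩
    tgt_ne := by
      rintro a (ha | ⟨hr, ha⟩) e
      · exact P.tgt_ne ha e
      · exact R.tgt_ne ha (e.trans (hx (e ▸ touches_tgt (R.mem_of_F ha))))
    pathEq := by
      rintro a (ha | ⟨hr, ha⟩)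
      · rw [if_pos (P.d_src ha), if_pos (P.d_tgt ha)]
        exact P.pathEq ha
      · rw [hgR hr (R.d_src ha), hgR hr (R.d_tgt ha)]
        simpa using (R.pathEq ha).append (P.g r) []
    isNull := by
      intro a ha hd hFa
      push Not at hFa
      rw [hZ] at ha
      rcases ha with ha | ha
      · have hP : P.d (Q.src a) := by
          rcases hd with hd | ⟨hr, hd⟩
          · exact hd
          · rcases R.eq_or_touches hd with e | hd
            · rwa [e]
            · rwa [h.eq_of_touches _ (touches_src ha) hd]
        rw [if_pos hP]
        exact P.isNull ha hP hFa.1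
      · have hR : P.d r ∧ R.d (Q.src a) := by
          rcases hd with hd | hd
          · have e : Q.src a = r := by
              rcases P.eq_or_touches hd with e | hd
              · rw [e]; exact hx (e ▸ touches_src ha)
              · exact h.eq_of_touches _ hd (touches_src ha)
            rw [e] at hd ⊢
            exact ⟨hd, R.d_self⟩
          · exact hd
        rw [hgR hR.1 hR.2]
        simpa using (R.isNull ha hR.2 (hFa.2 hR.1)).append (P.g r) []
    walk := by
      intro y hy
      by_cases hP : P.d y
      · rw [if_pos hP]
        exact (P.walk hP).mono fun a _ => Or.inl
      · obtain ⟨hr, hy⟩ := hy.resolve_left hP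
        rw [if_neg hP]
        exact ((P.walk hr).mono fun a _ => Or.inl).append
          ((R.walk hy).mono fun a _ ha => Or.inr ⟨hr, ha⟩)
    zero := by
      intro p hp hpZ y z w
      rcases h.zero p hp (hZ ▸ hpZ) with hX | hY
      · exact P.zero hp hX y z (w.mono fun a ha hFa => hF hFa (hX a ha))
      · exact R.zero hp hY y z (w.mono fun a ha hFa => (hF' hFa (hY a ha)).2)
    comm := by
      intro p q hpq hp hq y z
      rcases h.comm p q hpq (hZ ▸ hp) (hZ ▸ hq) with ⟨hX, hX'⟩ | ⟨hY, hY'⟩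
      · rw [walk_congr fun a ha => ⟨fun h => hF h (hX a ha), Or.inl⟩,
          walk_congr fun a ha => ⟨fun h => hF h (hX' a ha), Or.inl⟩, P.comm hpq hX hX']
      · by_cases hr : P.d r
        · rw [walk_congr fun a ha => ⟨fun h => (hF' h (hY a ha)).2, fun h => Or.inr ⟨hr, h⟩⟩,
            walk_congr fun a ha => ⟨fun h => (hF' h (hY' a ha)).2, fun h => Or.inr ⟨hr, h⟩⟩,
            R.comm hpq hY hY']
        -- Without a path to `r` no arrow of `Y` is available, so nonempty sides of a relation on
        -- `Y` are not walks. An empty side cannot face a nonempty one: the latter would have to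
        -- start both at `x` and at `r`.
        · have hxr : x ≠ r := fun e => hr (e ▸ P.d_self)
          have hR := R.comm hpq hY hY'
          cases p with
          | nil =>
            cases q with
            | nil => rfl
            | cons b q =>
              exact absurd (((hR x x).1 rfl).1.symm.trans ((hR r r).1 rfl).1) hxr
          | cons a p =>
            cases q with
            | nil => exact absurd (((hR x x).2 rfl).1.symm.trans ((hR r r).2 rfl).1) hxr
            | cons b q =>
              exact ⟨fun w => absurd (hF' w.2.1 (hY a (by simp))).1 hr,
                fun w => absurd (hF' w.2.1 (hY' b (by simp))).1 hr⟩ }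

end Glue

end ThinAt

/-- The set `X` of arrows admits a description of its nonzero paths, with Cartan determinant
`D`. -/
def HasThinDet (Q : BoundQuiver) (X : Set Q.E) (D : ℤ) : Prop :=
  ∃ P : ∀ x, ThinAt Q X x, (thinMatrix P).det = D

theorem HasThinDet.det_cartan (K : Type*) [Field K] {D : ℤ} (h : Q.HasThinDet Set.univ D) :
    (Q.cartan K).det = D := by
  obtain ⟨P, hP⟩ := h
  rw [cartan_eq K P, hP]

/-- A vertex strictly on the side of `Y` starts with its description in `Y` and continues through
`r` into `X`; all others start in `X`. Paths changing sides factor through `r`, which gives the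
block shape of `det_of_glue`. -/
theorem HasThinDet.union {D D' : ℤ} {r : Q.V} (hX : Q.HasThinDet X D) (hY : Q.HasThinDet Y D')
    (h : Q.Separated X Y r) : Q.HasThinDet (X ∪ Y) (D * D') := by
  classical
  obtain ⟨P, rfl⟩ := hX
  obtain ⟨R, rfl⟩ := hY
  let B : Q.V → Prop := fun x => Q.Touches Y x ∧ x ≠ r
  have hnB {x : Q.V} (hx : ¬ B x) : Q.Touches Y x → x = r := fun h => by
    by_contra e
    exact hx ⟨h, e⟩
  have hX {x : Q.V} (hx : B x) : ¬ Q.Touches X x := fun h' =>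
    hx.2 (h.eq_of_touches _ h' hx.1)
  let G : ∀ x, ThinAt Q (X ∪ Y) x := fun x =>
    if hx : B x then (R x).glue (P r) h.symm (fun h' => (hX hx h').elim) (Set.union_comm _ _)
    else (P x).glue (R r) h (hnB hx) rfl
  refine ⟨G, ?_⟩
  have hGd (x y : Q.V) : (G x).d y ↔
      if B x then ((R x).d y ∨ (R x).d r ∧ (P r).d y) else ((P x).d y ∨ (P x).d r ∧ (R r).d y) := by
    simp only [G]
    split_ifs <;> rfl
  refine det_of_glue B (r := r) (fun h => h.2 rfl) _ _ _ ?_ ?_ ?_ ?_ ?_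
  · simp [thinMatrix, ThinAt.d_self]
  · simp [thinMatrix, ThinAt.d_self]
  · intro x y hxy
    have : (P x).d y ↔ x = y := by
      refine ⟨fun hd => ?_, fun e => e ▸ (P x).d_self⟩
      rcases hxy with hx | hy
      · exact (((P x).eq_or_touches_left hd).resolve_right (hX hx)).symm
      · exact (((P x).eq_or_touches hd).resolve_right (hX hy)).symm
    simp [thinMatrix, this]
  · intro x y hxy
    have : (R x).d y ↔ x = y := by
      refine ⟨fun hd => ?_, fun e => e ▸ (R x).d_self⟩
      rcases hxy with ⟨hx, hx'⟩ | ⟨hy, hy'⟩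
      · exact (((R x).eq_or_touches_left hd).resolve_right fun h' => hx' (hnB hx h')).symm
      · exact (((R x).eq_or_touches hd).resolve_right fun h' => hy' (hnB hy h')).symm
    simp [thinMatrix, this]
  · intro x y
    have hand (p q : Prop) : (if p ∧ q then (1 : ℤ) else 0) =
        (if p then 1 else 0) * (if q then 1 else 0) := by
      by_cases p <;> by_cases q <;> simp [*]
    simp only [thinMatrix, hGd]
    by_cases hx : B x <;> by_cases hy : B y <;> simp only [hx, hy, if_true, if_false]
    · congr 1
      refine propext ⟨fun hd => hd.resolve_right fun hd' => ?_, Or.inl⟩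
      rcases (P r).eq_or_touches hd'.2 with e | h'
      · exact hy.2 e
      · exact hX hy h'
    · rw [← hand]
      congr 1
      refine propext ⟨fun h₀ => h₀.elim (fun hd => ?_) id, Or.inr⟩
      rcases (R x).eq_or_touches hd with rfl | h'
      · exact absurd hx hy
      · obtain rfl := hnB hy h'
        exact ⟨hd, (P y).d_self⟩
    · rw [← hand]
      congr 1
      refine propext ⟨fun hd => hd.resolve_left fun hd => ?_, Or.inr⟩
      rcases (P x).eq_or_touches hd with rfl | h'
      · exact hx hy
      · exact hX hy h'
    · congr 1
      refine propext ⟨fun hd => hd.elim id fun hd => ?_, Or.inl⟩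
      rcases (R r).eq_or_touches hd.2 with rfl | h'
      · exact hd.1
      · obtain rfl := hnB hy h'
        exact hd.1

lemma thinMatrix_eq_one (P : ∀ x, ThinAt Q ∅ x) : thinMatrix P = 1 := by
  ext x y
  have : (P x).d y ↔ x = y := by
    refine ⟨fun hd => ?_, fun e => e ▸ (P x).d_self⟩
    rcases (P x).eq_or_touches hd with e | ⟨a, ha, _⟩
    · exact e.symm
    · exact ha.elim
  simp [thinMatrix, this, Matrix.one_apply]

theorem hasThinDet_empty (hz : [] ∉ Q.zeroRel)
    (hc : ∀ p q, (p, q) ∈ Q.commRel → p ≠ [] ∧ q ≠ []) : Q.HasThinDet ∅ 1 := by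
  let P : ∀ x, ThinAt Q ∅ x := fun x => ThinAt.trivial (by rintro ⟨a, ha, _⟩; exact ha)
    (by rintro p hp _ rfl; exact hz hp) (fun p q h _ _ => hc p q h)
  exact ⟨P, by rw [thinMatrix_eq_one, Matrix.det_one]⟩

/-! ### Embeddings -/

/-- An embedding of quivers with relations onto a full subset of the relations. -/
structure Embedding (S R : BoundQuiver) where
  v : S.V → R.V
  e : S.E → R.E
  v_injective : Function.Injective v
  e_injective : Function.Injective e
  src (a : S.E) : R.src (e a) = v (S.src a)
  tgt (a : S.E) : R.tgt (e a) = v (S.tgt a)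
  zero {p : List S.E} : p ∈ S.zeroRel → p.map e ∈ R.zeroRel
  comm {p q : List S.E} : (p, q) ∈ S.commRel → (p.map e, q.map e) ∈ R.commRel
  exists_zero {p : List R.E} : p ∈ R.zeroRel → (∀ a ∈ p, a ∈ Set.range e) →
    ∃ q ∈ S.zeroRel, q ≠ [] ∧ p = q.map e
  exists_comm {p q : List R.E} : (p, q) ∈ R.commRel → (∀ a ∈ p, a ∈ Set.range e) →
    (∀ a ∈ q, a ∈ Set.range e) →
    ∃ r ∈ S.commRel, r.1 ≠ [] ∧ r.2 ≠ [] ∧ p = r.1.map e ∧ q = r.2.map e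

namespace Embedding

variable {S R : BoundQuiver} (f : Embedding S R)

include f in
lemma pathEq {p q : List S.E} (h : S.PathEq p q) : R.PathEq (p.map f.e) (q.map f.e) := by
  induction h with
  | refl p => exact .refl _
  | symm _ ih => exact ih.symm
  | trans _ _ ih₁ ih₂ => exact ih₁.trans ih₂
  | comm u v h => simpa using PathEq.comm (u.map f.e) (v.map f.e) (f.comm h)

lemma isNull {p : List S.E} (h : S.IsNull p) : R.IsNull (p.map f.e) := by
  obtain ⟨u, z, v, hz, h⟩ := h
  exact ⟨u.map f.e, z.map f.e, v.map f.e, f.zero hz, by simpa using f.pathEq h⟩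

lemma walk_map {F : S.E → Prop} {p : List S.E} {x y : S.V} :
    R.Walk (fun b => ∃ a, f.e a = b ∧ F a) (f.v x) (p.map f.e) (f.v y) ↔ S.Walk F x p y := by
  induction p generalizing x with
  | nil => exact f.v_injective.eq_iff
  | cons a p ih =>
    simp only [List.map_cons, Walk, f.src, f.tgt, ih, f.v_injective.eq_iff, f.e_injective.eq_iff,
      exists_eq_left]

/-- The list must be nonempty since an empty walk may sit at a vertex outside the image. This is why
`exists_zero` and `exists_comm` supply nonempty relations. -/
lemma mem_range_of_walk {F : S.E → Prop} {p : List S.E} (hp : p ≠ []) {x y : R.V}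
    (w : R.Walk (fun b => ∃ a, f.e a = b ∧ F a) x (p.map f.e) y) :
    (∃ z, f.v z = x) ∧ ∃ z, f.v z = y := by
  induction p generalizing x with
  | nil => exact absurd rfl hp
  | cons a p ih =>
    refine ⟨⟨_, (f.src a).symm.trans w.1⟩, ?_⟩
    by_cases hp : p = []
    · subst hp
      exact ⟨_, (f.tgt a).symm.trans w.2.2⟩
    · exact (ih hp w.2.2).2

open Classical in
/-- The image of a description of nonzero paths under an embedding. -/
noncomputable def thinAt {x : S.V} (P : ThinAt S Set.univ x) : ThinAt R (Set.range f.e) (f.v x) := by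
  have hg (y : S.V) : (if h : ∃ z, f.v z = f.v y then (P.g h.choose).map f.e else []) =
      (P.g y).map f.e := by
    have h : ∃ z, f.v z = f.v y := ⟨y, rfl⟩
    rw [dif_pos h, f.v_injective h.choose_spec]
  exact
  { F b := ∃ a, f.e a = b ∧ P.F a
    d y := ∃ z, f.v z = y ∧ P.d z
    g y := if h : ∃ z, f.v z = y then (P.g h.choose).map f.e else []
    d_self := ⟨x, rfl, P.d_self⟩
    g_self := by rw [hg, P.g_self]; rfl
    mem_of_F := by rintro _ ⟨a, rfl, _⟩; exact ⟨a, rfl⟩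
    d_src := by rintro _ ⟨a, rfl, ha⟩; exact ⟨_, (f.src a).symm, P.d_src ha⟩
    d_tgt := by rintro _ ⟨a, rfl, ha⟩; exact ⟨_, (f.tgt a).symm, P.d_tgt ha⟩
    tgt_ne := by
      rintro _ ⟨a, rfl, ha⟩ h
      rw [f.tgt] at h
      exact P.tgt_ne ha (f.v_injective h)
    pathEq := by
      rintro _ ⟨a, rfl, ha⟩
      rw [f.src, f.tgt, hg, hg]
      simpa using f.pathEq (P.pathEq ha)
    isNull := by
      rintro _ ⟨a, rfl⟩ ⟨z, hz, hd⟩ hF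
      rw [f.src] at hz ⊢
      obtain rfl := f.v_injective hz
      rw [hg]
      simpa using f.isNull (P.isNull (Set.mem_univ a) hd fun h => hF ⟨a, rfl, h⟩)
    walk := by
      rintro _ ⟨y, rfl, hy⟩
      rw [hg, f.walk_map]
      exact P.walk hy
    zero := by
      intro p hp hpr y z w
      obtain ⟨q, hq, hq0, rfl⟩ := f.exists_zero hp hpr
      obtain ⟨⟨y, rfl⟩, ⟨z, rfl⟩⟩ := f.mem_range_of_walk hq0 w
      exact P.zero hq (by simp) y z (f.walk_map.1 w)
    comm := by
      intro p p' hp hpr hpr' y z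
      obtain ⟨⟨q, q'⟩, hq, hq0, hq0', rfl, rfl⟩ := f.exists_comm hp hpr hpr'
      constructor
      · intro w
        obtain ⟨⟨y, rfl⟩, ⟨z, rfl⟩⟩ := f.mem_range_of_walk hq0 w
        exact f.walk_map.2 ((P.comm hq (by simp) (by simp) y z).1 (f.walk_map.1 w))
      · intro w
        obtain ⟨⟨y, rfl⟩, ⟨z, rfl⟩⟩ := f.mem_range_of_walk hq0' w
        exact f.walk_map.2 ((P.comm hq (by simp) (by simp) y z).2 (f.walk_map.1 w)) }

-- Vertices outside the image touch no arrow in it and contribute identity rows and columns, which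
-- `det_eq_det_submatrix` removes.
include f in
theorem hasThinDet {D : ℤ} (h : S.HasThinDet Set.univ D) : R.HasThinDet (Set.range f.e) D := by
  classical
  obtain ⟨P, rfl⟩ := h
  have hnot {x : R.V} (hx : ¬ ∃ z, f.v z = x) : ¬ R.Touches (Set.range f.e) x := by
    rintro ⟨_, ⟨a, rfl⟩, h | h⟩
    · exact hx ⟨_, (f.src a).symm.trans h⟩
    · exact hx ⟨_, (f.tgt a).symm.trans h⟩
  let G : ∀ x, ThinAt R (Set.range f.e) x := fun x =>
    if hx : ∃ z, f.v z = x then hx.choose_spec ▸ f.thinAt (P hx.choose)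
    else ThinAt.trivial (hnot hx)
      (fun p hp hpr => by
        obtain ⟨q, _, hq, rfl⟩ := f.exists_zero hp hpr
        simpa using hq)
      (fun p q h hp hq => by
        obtain ⟨r, _, h₁, h₂, rfl, rfl⟩ := f.exists_comm h hp hq
        simpa using ⟨h₁, h₂⟩)
  -- By injectivity the chosen preimage is `x`, so the transport in the definition of `G`
  -- disappears.
  have hG (x : S.V) : G (f.v x) = f.thinAt (P x) := by
    have h : ∃ z, f.v z = f.v x := ⟨x, rfl⟩
    simp only [G]
    rw [dif_pos h]
    have e : h.choose = x := f.v_injective h.choose_spec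
    generalize_proofs h'
    generalize h.choose = z at e h'
    subst e
    rfl
  refine ⟨G, ?_⟩
  rw [det_eq_det_submatrix f.v_injective]
  · congr 1
    ext x y
    have : (∃ z, f.v z = f.v y ∧ (P x).d z) ↔ (P x).d y := by
      simp [f.v_injective.eq_iff]
    simp only [Matrix.submatrix_apply, thinMatrix, hG]
    simp only [thinAt, this]
  · intro x y hxy
    have : (G x).d y ↔ x = y := by
      refine ⟨fun hd => ?_, fun e => e ▸ (G x).d_self⟩
      rcases hxy with h | h
      · exact (((G x).eq_or_touches_left hd).resolve_right (hnot h)).symm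
      · exact (((G x).eq_or_touches hd).resolve_right (hnot h)).symm
    simp [thinMatrix, this]

end Embedding

end BoundQuiver

/-! ### Gluing -/

lemma RootedTypeA.ne_nil_of_mem (R : RootedTypeA) {p : List R.bound.E} (h : p ∈ R.bound.zeroRel) :
    p ≠ [] := by
  obtain ⟨a, b, c, _, rfl⟩ := h
  exact List.cons_ne_nil _ _

section Gluing

open BoundQuiver

variable {S : BoundQuiver} {J : Type} [Fintype J] [DecidableEq J]
  {c : J → S.V} {Q : J → RootedTypeA}

variable (S c Q) in
/-- An arrow of the skeleton as an arrow of the gluing. -/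
def skeletonArrow (a : S.E) : (glue S c Q).E := Sum.inl a

variable (S c Q) in
/-- An arrow of a piece as an arrow of the gluing. -/
def pieceArrow (j : J) (a : (Q j).bound.E) : (glue S c Q).E := Sum.inr ⟨j, a⟩

variable (S c Q) in
/-- A vertex of the skeleton as a vertex of the gluing. -/
def skeletonVertex (x : S.V) : (glue S c Q).V := Sum.inl x

variable (S c Q) in
/-- A vertex of a piece as a vertex of the gluing. -/
def pieceVertex (j : J) (x : (Q j).bound.V) : (glue S c Q).V := glueMap S c Q j x

lemma skeletonArrow_injective : Function.Injective (skeletonArrow S c Q) := Sum.inl_injective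

lemma pieceArrow_inj {j k : J} {a : (Q j).bound.E} {b : (Q k).bound.E}
    (h : pieceArrow S c Q j a = pieceArrow S c Q k b) :
    (⟨j, a⟩ : Σ j, (Q j).bound.E) = ⟨k, b⟩ := Sum.inr_injective h

lemma pieceArrow_injective (j : J) : Function.Injective (pieceArrow S c Q j) :=
  fun _ _ h => eq_of_heq (Sigma.mk.inj (pieceArrow_inj h)).2

lemma index_eq_of_pieceArrow {j k : J} {a : (Q j).bound.E} {b : (Q k).bound.E}
    (h : pieceArrow S c Q j a = pieceArrow S c Q k b) : j = k :=
  (Sigma.mk.inj (pieceArrow_inj h)).1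

lemma skeletonArrow_ne_pieceArrow {a : S.E} {j : J} {b : (Q j).bound.E} :
    skeletonArrow S c Q a ≠ pieceArrow S c Q j b := Sum.inl_ne_inr

lemma exists_eq_arrow (b : (glue S c Q).E) :
    (∃ a, b = skeletonArrow S c Q a) ∨ ∃ j a, b = pieceArrow S c Q j a := by
  rcases b with a | ⟨j, a⟩
  · exact Or.inl ⟨a, rfl⟩
  · exact Or.inr ⟨j, a, rfl⟩

lemma skeletonVertex_injective : Function.Injective (skeletonVertex S c Q) := Sum.inl_injective

lemma pieceVertex_root (j : J) :
    pieceVertex S c Q j (Q j).root = skeletonVertex S c Q (c j) := dif_pos rfl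

lemma pieceVertex_of_ne {j : J} {x : (Q j).V} (h : x ≠ (Q j).root) :
    pieceVertex S c Q j x = (Sum.inr ⟨j, x, h⟩ : GlueVertex S Q) := dif_neg h

lemma eq_root_of_pieceVertex {j : J} {x : (Q j).V} {y : S.V}
    (h : pieceVertex S c Q j x = skeletonVertex S c Q y) : x = (Q j).root := by
  by_contra hx
  exact Sum.inr_ne_inl ((pieceVertex_of_ne hx).symm.trans h)

lemma pieceVertex_inj {j k : J} {x : (Q j).V} {y : (Q k).V} (hx : x ≠ (Q j).root)
    (h : pieceVertex S c Q j x = pieceVertex S c Q k y) :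
    (⟨j, x⟩ : Σ j, (Q j).V) = ⟨k, y⟩ := by
  by_cases hy : y = (Q k).root
  · subst hy
    exact absurd (eq_root_of_pieceVertex (h.trans (pieceVertex_root k))) hx
  · have := (pieceVertex_of_ne (c := c) hx).symm.trans (h.trans (pieceVertex_of_ne hy))
    have h1 := Sum.inr_injective this
    exact congrArg (fun u : Σ j, {x : (Q j).V // x ≠ (Q j).root} =>
      (⟨u.1, u.2.1⟩ : Σ j, (Q j).V)) h1

lemma pieceVertex_injective (j : J) : Function.Injective (pieceVertex S c Q j) := by
  intro x y h
  by_cases hx : x = (Q j).root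
  · by_cases hy : y = (Q j).root
    · exact hx.trans hy.symm
    · exact (eq_of_heq (Sigma.mk.inj (pieceVertex_inj hy h.symm)).2).symm
  · exact eq_of_heq (Sigma.mk.inj (pieceVertex_inj hx h)).2

lemma mem_zeroRel_glue {p : List (glue S c Q).E} (h : p ∈ (glue S c Q).zeroRel) :
    (∃ q ∈ S.zeroRel, p = q.map (skeletonArrow S c Q)) ∨
      ∃ j, ∃ q ∈ (Q j).bound.zeroRel, p = q.map (pieceArrow S c Q j) := h

lemma mem_commRel_glue {p q : List (glue S c Q).E} (h : (p, q) ∈ (glue S c Q).commRel) :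
    ∃ r ∈ S.commRel, p = r.1.map (skeletonArrow S c Q) ∧ q = r.2.map (skeletonArrow S c Q) := by
  rcases h with ⟨r, hr, h⟩ | ⟨j, r, hr, _⟩
  · exact ⟨r, hr, (Prod.mk.inj h).1, (Prod.mk.inj h).2⟩
  · exact hr.elim

lemma exists_mem_of_ne_nil_map {α β : Type*} {f : α → β} {p : List α} (hp : p ≠ [])
    {P : β → Prop} (h : ∀ b ∈ p.map f, P b) : ∃ a, P (f a) := by
  obtain ⟨a, q, rfl⟩ := List.exists_cons_of_ne_nil hp
  exact ⟨a, h _ (List.mem_cons_self ..)⟩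

section Embeddings

variable (S c Q)

/-- The skeleton is embedded into the gluing. -/
def skeletonEmbedding (hz : ∀ p ∈ S.zeroRel, p ≠ [])
    (hc : ∀ p q, (p, q) ∈ S.commRel → p ≠ [] ∧ q ≠ []) : Embedding S (glue S c Q) where
  v := skeletonVertex S c Q
  e := skeletonArrow S c Q
  v_injective := skeletonVertex_injective
  e_injective := skeletonArrow_injective
  src _ := rfl
  tgt _ := rfl
  zero h := Or.inl ⟨_, h, rfl⟩
  comm h := Or.inl ⟨_, h, rfl⟩
  exists_zero := by
    intro p hp h
    rcases mem_zeroRel_glue hp with ⟨q, hq, rfl⟩ | ⟨j, q, hq, rfl⟩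
    · exact ⟨q, hq, hz q hq, rfl⟩
    · obtain ⟨a, b, hb⟩ := exists_mem_of_ne_nil_map ((Q j).ne_nil_of_mem hq) h
      exact absurd hb skeletonArrow_ne_pieceArrow
  exists_comm := by
    intro p p' hp _ _
    obtain ⟨q, hq, h⟩ := mem_commRel_glue hp
    exact ⟨q, hq, (hc _ _ hq).1, (hc _ _ hq).2, h.1, h.2⟩

/-- The pieces are embedded into the gluing. -/
def pieceEmbedding (hz : ∀ p ∈ S.zeroRel, p ≠ [])
    (hc : ∀ p q, (p, q) ∈ S.commRel → p ≠ [] ∧ q ≠ []) (j : J) :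
    Embedding (Q j).bound (glue S c Q) where
  v := pieceVertex S c Q j
  e := pieceArrow S c Q j
  v_injective := pieceVertex_injective j
  e_injective := pieceArrow_injective j
  src _ := rfl
  tgt _ := rfl
  zero h := Or.inr ⟨j, _, h, rfl⟩
  comm h := h.elim
  exists_zero := by
    intro p hp h
    rcases mem_zeroRel_glue hp with ⟨q, hq, rfl⟩ | ⟨k, q, hq, rfl⟩
    · obtain ⟨a, b, hb⟩ := exists_mem_of_ne_nil_map (hz q hq) h
      exact absurd hb.symm skeletonArrow_ne_pieceArrow
    · have hq0 := (Q k).ne_nil_of_mem hq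
      obtain ⟨a, b, hb⟩ := exists_mem_of_ne_nil_map hq0 h
      obtain rfl := index_eq_of_pieceArrow hb
      exact ⟨q, hq, hq0, rfl⟩
  exists_comm := by
    intro p p' hp h _
    obtain ⟨q, hq, rfl, rfl⟩ := mem_commRel_glue hp
    obtain ⟨a, b, hb⟩ := exists_mem_of_ne_nil_map (hc _ _ hq).1 h
    exact absurd hb.symm skeletonArrow_ne_pieceArrow

/-- The arrows of the skeleton and of the pieces with index in `s`. -/
def glueArrows (s : Finset J) : Set (glue S c Q).E :=
  {b | (∃ a, b = skeletonArrow S c Q a) ∨ ∃ j ∈ s, ∃ a, b = pieceArrow S c Q j a}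

/-- A piece meets the skeleton and the other pieces only in its root, and each relation of the
gluing comes from the skeleton or from a single piece. -/
lemma separated_glueArrows {s : Finset J} {j : J} (hj : j ∉ s) :
    (glue S c Q).Separated (glueArrows S c Q s) (Set.range (pieceArrow S c Q j))
      (skeletonVertex S c Q (c j)) where
  disjoint := by
    rintro _ (⟨a, rfl⟩ | ⟨k, hk, a, rfl⟩) ⟨b, hb⟩
    · exact skeletonArrow_ne_pieceArrow hb.symm
    · exact hj (index_eq_of_pieceArrow hb ▸ hk)
  eq_of_touches := by
    have hY : ∀ v, (glue S c Q).Touches (Set.range (pieceArrow S c Q j)) v →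
        ∃ x, pieceVertex S c Q j x = v := by
      rintro v ⟨_, ⟨a, rfl⟩, h | h⟩
      · exact ⟨_, h⟩
      · exact ⟨_, h⟩
    have hX : ∀ v, (glue S c Q).Touches (glueArrows S c Q s) v →
        (∃ x, skeletonVertex S c Q x = v) ∨ ∃ k ∈ s, ∃ x, pieceVertex S c Q k x = v := by
      rintro v ⟨_, ⟨a, rfl⟩ | ⟨k, hk, a, rfl⟩, h | h⟩
      · exact Or.inl ⟨_, h⟩
      · exact Or.inl ⟨_, h⟩
      · exact Or.inr ⟨k, hk, _, h⟩
      · exact Or.inr ⟨k, hk, _, h⟩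
    intro v hv hv'
    obtain ⟨x, rfl⟩ := hY v hv'
    by_cases hx : x = (Q j).root
    · rw [hx]; exact pieceVertex_root j
    · rcases hX _ hv with ⟨y, hy⟩ | ⟨k, hk, y, hy⟩
      · exact absurd (eq_root_of_pieceVertex hy.symm) hx
      · have := (Sigma.mk.inj (pieceVertex_inj hx hy.symm)).1
        exact absurd (this ▸ hk) hj
  zero := by
    intro p hp h
    rcases mem_zeroRel_glue hp with ⟨q, hq, rfl⟩ | ⟨k, q, hq, rfl⟩
    · left
      intro a ha
      obtain ⟨b, _, rfl⟩ := List.mem_map.1 ha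
      exact Or.inl ⟨b, rfl⟩
    · obtain ⟨a, (⟨b, hb⟩ | ⟨l, hl, b, hb⟩) | ⟨b, hb⟩⟩ :=
        exists_mem_of_ne_nil_map ((Q k).ne_nil_of_mem hq) h
      · exact absurd hb.symm skeletonArrow_ne_pieceArrow
      · obtain rfl := index_eq_of_pieceArrow hb
        left
        intro a ha
        obtain ⟨b, _, rfl⟩ := List.mem_map.1 ha
        exact Or.inr ⟨k, hl, b, rfl⟩
      · obtain rfl := index_eq_of_pieceArrow hb
        right
        intro a ha
        obtain ⟨b, _, rfl⟩ := List.mem_map.1 ha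
        exact ⟨b, rfl⟩
  comm := by
    intro p p' hp _ _
    obtain ⟨q, hq, rfl, rfl⟩ := mem_commRel_glue hp
    left
    constructor <;>
    · intro a ha
      obtain ⟨b, _, rfl⟩ := List.mem_map.1 ha
      exact Or.inl ⟨b, rfl⟩

/-- The pieces are attached one at a time by `HasThinDet.union`. Nonemptiness of the relations lets
an arrow tell which part a relation comes from. -/
theorem hasThinDet_glue {D : ℤ} {D' : J → ℤ} (hS : S.HasThinDet Set.univ D)
    (hQ : ∀ j, (Q j).bound.HasThinDet Set.univ (D' j)) (hz : ∀ p ∈ S.zeroRel, p ≠ [])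
    (hc : ∀ p q, (p, q) ∈ S.commRel → p ≠ [] ∧ q ≠ []) :
    (glue S c Q).HasThinDet Set.univ (D * ∏ j, D' j) := by
  have key (s : Finset J) :
      (glue S c Q).HasThinDet (glueArrows S c Q s) (D * ∏ j ∈ s, D' j) := by
    induction s using Finset.induction_on with
    | empty =>
      have : glueArrows S c Q ∅ = Set.range (skeletonArrow S c Q) := by
        ext b
        simp [glueArrows, eq_comm]
      rw [this, Finset.prod_empty, mul_one]
      exact (skeletonEmbedding S c Q hz hc).hasThinDet hS
    | insert j s hj ih =>
      have : glueArrows S c Q (insert j s) =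
          glueArrows S c Q s ∪ Set.range (pieceArrow S c Q j) := by
        ext b
        constructor
        · rintro (⟨a, rfl⟩ | ⟨k, hk, a, rfl⟩)
          · exact Or.inl (Or.inl ⟨a, rfl⟩)
          · rcases Finset.mem_insert.1 hk with rfl | hk
            · exact Or.inr ⟨a, rfl⟩
            · exact Or.inl (Or.inr ⟨k, hk, a, rfl⟩)
        · rintro ((⟨a, rfl⟩ | ⟨k, hk, a, rfl⟩) | ⟨a, rfl⟩)
          · exact Or.inl ⟨a, rfl⟩
          · exact Or.inr ⟨k, Finset.mem_insert_of_mem hk, a, rfl⟩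
          · exact Or.inr ⟨j, Finset.mem_insert_self .., a, rfl⟩
      rw [this, Finset.prod_insert hj, mul_comm (D' j), ← mul_assoc]
      exact ih.union ((pieceEmbedding S c Q hz hc j).hasThinDet (hQ j))
        (separated_glueArrows S c Q hj)
  have huniv : glueArrows S c Q Finset.univ = Set.univ := by
    ext b
    rcases exists_eq_arrow b with ⟨a, rfl⟩ | ⟨j, a, rfl⟩
    · exact iff_of_true (Or.inl ⟨a, rfl⟩) trivial
    · exact iff_of_true (Or.inr ⟨j, Finset.mem_univ _, a, rfl⟩) trivial
  rw [← huniv]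
  exact key _

end Embeddings

end Gluing

/-! ### Triangulations of a polygon and mutation

A plane binary tree encodes a triangulation of a polygon with a distinguished side: the nodes are
the triangles, and the label of a node is that of the edge joining it to its parent. -/

/-- Plane binary trees with labelled nodes. -/
inductive PlaneTree (ι : Type*)
  | leaf : PlaneTree ι
  | node (k : ι) (l r : PlaneTree ι) : PlaneTree ι

namespace PlaneTree

variable {ι : Type*}

/-- The label of the root. -/
def root : PlaneTree ι → Option ι
  | leaf => none
  | node k _ _ => some k

@[simp] lemma root_leaf : (leaf : PlaneTree ι).root = none := rfl

@[simp] lemma root_node (k : ι) (l r : PlaneTree ι) : (node k l r).root = some k := rfl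

/-- The labels of a tree. -/
def labels : PlaneTree ι → List ι
  | leaf => []
  | node k l r => k :: (l.labels ++ r.labels)

lemma mem_labels_of_root {t : PlaneTree ι} {i : ι} (h : t.root = some i) : i ∈ t.labels := by
  cases t with
  | leaf => simp [root] at h
  | node k l r => simp [root] at h; simp [labels, h]

/-- The consecutive pairs in the cyclic order of the sides of a triangle. -/
def TriPair (o a b : Option ι) (i j : ι) : Prop :=
  (o = some i ∧ a = some j) ∨ (a = some i ∧ b = some j) ∨ (b = some i ∧ o = some j)

/-- The consecutive pairs of sides in the triangles of a tree. -/
def Pair : PlaneTree ι → ι → ι → Prop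
  | leaf, _, _ => False
  | node k l r, i, j => TriPair (some k) l.root r.root i j ∨ l.Pair i j ∨ r.Pair i j

/-- The consecutive pairs of sides in a triangulation with top triangle `(o, l, r)`. -/
def TopPair (o : Option ι) (l r : PlaneTree ι) (i j : ι) : Prop :=
  TriPair o l.root r.root i j ∨ l.Pair i j ∨ r.Pair i j

lemma Pair.mem {t : PlaneTree ι} {i j : ι} (h : t.Pair i j) : i ∈ t.labels ∧ j ∈ t.labels := by
  induction t with
  | leaf => exact h.elim
  | node k l r hl hr =>
    simp only [labels, List.mem_cons, List.mem_append]
    rcases h with (⟨h, h'⟩ | ⟨h, h'⟩ | ⟨h, h'⟩) | h | h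
    · simp only [Option.some.injEq] at h
      exact ⟨.inl h.symm, .inr (.inl (mem_labels_of_root h'))⟩
    · exact ⟨.inr (.inl (mem_labels_of_root h)), .inr (.inr (mem_labels_of_root h'))⟩
    · simp only [Option.some.injEq] at h'
      exact ⟨.inr (.inr (mem_labels_of_root h)), .inl h'.symm⟩
    · exact ⟨.inr (.inl (hl h).1), .inr (.inl (hl h).2)⟩
    · exact ⟨.inr (.inr (hr h).1), .inr (.inr (hr h).2)⟩

variable [DecidableEq ι]

/-- The indicator function of an optional label. -/
def ind (o : Option ι) (i : ι) : ℤ := if o = some i then 1 else 0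

@[simp] lemma ind_none (i : ι) : ind none i = 0 := by simp [ind]

lemma ind_of_ne {o : Option ι} {i : ι} (h : o ≠ some i) : ind o i = 0 := if_neg h

@[simp] lemma ind_some_self (i : ι) : ind (some i) i = 1 := if_pos rfl

lemma ind_of_eq {o : Option ι} {i : ι} (h : o = some i) : ind o i = 1 := if_pos h

/-- The skew-symmetric matrix of a single arrow. -/
def arrowMatrix (o p : Option ι) : Matrix ι ι ℤ := fun i j => ind o i * ind p j - ind o j * ind p i

/-- The skew-symmetric matrix of a triangle. -/
def triMatrix (o a b : Option ι) : Matrix ι ι ℤ :=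
  arrowMatrix o a + arrowMatrix a b + arrowMatrix b o

lemma triMatrix_apply (o a b : Option ι) (i j : ι) : triMatrix o a b i j =
    ind o i * ind a j - ind o j * ind a i + (ind a i * ind b j - ind a j * ind b i) +
      (ind b i * ind o j - ind b j * ind o i) := rfl

/-- The skew-symmetric matrix of a tree. -/
def mat : PlaneTree ι → Matrix ι ι ℤ
  | leaf => 0
  | node k l r => triMatrix (some k) l.root r.root + l.mat + r.mat

/-- The skew-symmetric matrix of a triangulation with top triangle `(o, l, r)`. -/
def topMatrix (o : Option ι) (l r : PlaneTree ι) : Matrix ι ι ℤ :=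
  triMatrix o l.root r.root + l.mat + r.mat

lemma triMatrix_rotate (o a b : Option ι) : triMatrix o a b = triMatrix a b o := by
  unfold triMatrix; abel

lemma mat_eq_zero {t : PlaneTree ι} {i : ι} (h : i ∉ t.labels) (j : ι) :
    t.mat i j = 0 ∧ t.mat j i = 0 := by
  induction t with
  | leaf => simp [mat]
  | node k l r hl hr =>
    simp only [labels, List.mem_cons, List.mem_append, not_or] at h
    have h1 : ind (some k) i = 0 := ind_of_ne (by simpa using Ne.symm h.1)
    have h2 : ind l.root i = 0 := ind_of_ne fun e => h.2.1 (mem_labels_of_root e)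
    have h3 : ind r.root i = 0 := ind_of_ne fun e => h.2.2 (mem_labels_of_root e)
    simp [mat, triMatrix_apply, h1, h2, h3, hl h.2.1, hr h.2.2]

/-- The correction terms of a mutation use only row and column `k`. Hence mutation is local:
triangles without the side `k` pass through unchanged. -/
lemma mutate_add {k : ι} {B N : Matrix ι ι ℤ} (h : ∀ i, N i k = 0 ∧ N k i = 0) :
    mutate k (B + N) = mutate k B + N := by
  ext i j
  simp only [mutate, Matrix.add_apply, h, add_zero]
  split_ifs with hij
  · rcases hij with rfl | rfl <;> simp [h]
  · ring

/-- This is the flip of the diagonal `k` in the quadrilateral with sides `o, a, b, c`: the triangles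
`(o, k, c)` and `(k, a, b)` become `(o, a, k)` and `(k, b, c)`. -/
lemma mutate_triMatrix {k : ι} {o a b c : Option ι} (hok : o ≠ some k) (hak : a ≠ some k)
    (hbk : b ≠ some k) (hck : c ≠ some k) (hoa : ∀ i, o = some i → a ≠ some i)
    (hob : ∀ i, o = some i → b ≠ some i) (hoc : ∀ i, o = some i → c ≠ some i)
    (hab : ∀ i, a = some i → b ≠ some i) (hac : ∀ i, a = some i → c ≠ some i)
    (hbc : ∀ i, b = some i → c ≠ some i) :
    mutate k (triMatrix o (some k) c + triMatrix (some k) a b) =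
      triMatrix o a (some k) + triMatrix (some k) b c := by
  have e1 := ind_of_ne hok
  have e2 := ind_of_ne hak
  have e3 := ind_of_ne hbk
  have e4 := ind_of_ne hck
  -- Column `k` is positive at `o`, `b` and negative at `a`, `c`. As the four labels are distinct,
  -- the positive and negative parts do not cancel.
  have hpos (i : ι) : max (ind o i - ind c i - ind a i + ind b i) 0 = ind o i + ind b i := by
    simp only [ind]
    split_ifs <;> simp_all
  have hneg (i : ι) : max (ind c i + ind a i - ind o i - ind b i) 0 = ind c i + ind a i := by
    simp only [ind]
    split_ifs <;> simp_all
  ext i j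
  simp only [mutate, Matrix.add_apply, triMatrix_apply]
  split_ifs with h
  · rcases h with rfl | rfl
    · simp only [e1, e2, e3, e4, ind_some_self]; ring
    · simp only [e1, e2, e3, e4, ind_some_self]; ring
  · push Not at h
    have hi : ind (some k) i = 0 := ind_of_ne (by simpa using Ne.symm h.1)
    have hj : ind (some k) j = 0 := ind_of_ne (by simpa using Ne.symm h.2)
    have hp := hpos i
    have hp' := hpos j
    have hn := hneg i
    have hn' := hneg j
    simp only [e1, e2, e3, e4, hi, hj, ind_some_self]
    ring_nf at hp hp' hn hn' ⊢
    rw [hp, hp', hn, hn']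
    ring

/-- If `k` labels the root of `l` or `r`, the flip is a tree rotation. Otherwise `k` lies below some
node `a`, and the claim is applied to that subtree with `a` as its top side, which is why `o` is
arbitrary. -/
theorem exists_topMatrix_eq_mutate (k : ι) (l r : PlaneTree ι) (o : Option ι)
    (hn : (o.toList ++ (l.labels ++ r.labels)).Nodup) (hk : k ∈ l.labels ++ r.labels) :
    ∃ l' r' : PlaneTree ι, (l'.labels ++ r'.labels).Perm (l.labels ++ r.labels) ∧
      topMatrix o l' r' = mutate k (topMatrix o l r) := by
  simp only [List.nodup_append, List.mem_append, Option.mem_toList] at hn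
  obtain ⟨-, ⟨hl, hr, hlr⟩, ho⟩ := hn
  have hok : o ≠ some k := fun h => ho k h k (List.mem_append.1 hk) rfl
  rcases List.mem_append.1 hk with hkl | hkr
  · have hkr : k ∉ r.labels := fun h => hlr k hkl k h rfl
    cases l with
    | leaf => simp [labels] at hkl
    | node a l₁ l₂ =>
      simp only [labels, List.nodup_cons, List.nodup_append, List.mem_append] at hl
      by_cases hka : k = a
      · subst hka
        refine ⟨l₁, node k l₂ r, ?_, ?_⟩
        · simp only [labels, List.cons_append, List.append_assoc]
          exact List.perm_middle
        · have h := mutate_triMatrix (k := k) (o := o) (a := l₁.root) (b := l₂.root) (c := r.root)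
            hok (fun h => hl.1 (.inl (mem_labels_of_root h)))
            (fun h => hl.1 (.inr (mem_labels_of_root h)))
            (fun h => hkr (mem_labels_of_root h))
            (fun i h h' => ho i h i (.inl (by simp [labels, mem_labels_of_root h'])) rfl)
            (fun i h h' => ho i h i (.inl (by simp [labels, mem_labels_of_root h'])) rfl)
            (fun i h h' => ho i h i (.inr (mem_labels_of_root h')) rfl)
            (fun i h h' => hl.2.2.2 i (mem_labels_of_root h) i (mem_labels_of_root h') rfl)
            (fun i h h' => hlr i (by simp [labels, mem_labels_of_root h]) i
              (mem_labels_of_root h') rfl)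
            (fun i h h' => hlr i (by simp [labels, mem_labels_of_root h]) i
              (mem_labels_of_root h') rfl)
          have h2 : ∀ i, (l₁.mat + l₂.mat + r.mat) i k = 0 ∧ (l₁.mat + l₂.mat + r.mat) k i = 0 := by
            intro i
            simp [mat_eq_zero fun h => hl.1 (.inl h),
              mat_eq_zero fun h => hl.1 (.inr h), mat_eq_zero hkr]
          have h3 := mutate_add (B := triMatrix o (some k) r.root +
            triMatrix (some k) l₁.root l₂.root) h2
          rw [h] at h3
          simp only [topMatrix, mat, root_node]
          rw [show triMatrix o (some k) r.root + (triMatrix (some k) l₁.root l₂.root +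
            l₁.mat + l₂.mat) + r.mat = triMatrix o (some k) r.root +
            triMatrix (some k) l₁.root l₂.root + (l₁.mat + l₂.mat + r.mat) by abel, h3]
          abel
      · have hk' : k ∈ l₁.labels ++ l₂.labels := by
          simpa [labels, hka] using hkl
        obtain ⟨l₁', l₂', hp, hm⟩ := exists_topMatrix_eq_mutate k l₁ l₂ (some a)
          (by simp only [Option.toList_some, List.cons_append, List.nil_append, List.nodup_cons,
                List.nodup_append, List.mem_append]
              exact hl) hk'
        refine ⟨node a l₁' l₂', r, ?_, ?_⟩
        · simp only [labels, List.cons_append]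
          exact (hp.append_right _).cons _
        · have hN : ∀ i, (triMatrix o (some a) r.root + r.mat) i k = 0 ∧
              (triMatrix o (some a) r.root + r.mat) k i = 0 := by
            intro i
            have h1 := ind_of_ne hok
            have h2 : ind (some a) k = 0 := ind_of_ne (by simpa using Ne.symm hka)
            have h3 : ind r.root k = 0 := ind_of_ne fun h => hkr (mem_labels_of_root h)
            simp [triMatrix_apply, h1, h2, h3, mat_eq_zero hkr]
          have h3 := mutate_add (B := topMatrix (some a) l₁ l₂) hN
          rw [← hm] at h3
          have e (u v : PlaneTree ι) : topMatrix o (node a u v) r = topMatrix (some a) u v +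
              (triMatrix o (some a) r.root + r.mat) := by
            simp only [topMatrix, mat, root_node]; abel
          rw [e, e, h3]
  · have hkl : k ∉ l.labels := fun h => hlr k h k hkr rfl
    cases r with
    | leaf => simp [labels] at hkr
    | node a r₁ r₂ =>
      simp only [labels, List.nodup_cons, List.nodup_append, List.mem_append] at hr
      by_cases hka : k = a
      · subst hka
        refine ⟨node k l r₁, r₂, ?_, ?_⟩
        · simp only [labels, List.cons_append, List.append_assoc]
          exact List.perm_middle.symm
        -- The quadrilateral is read starting from the root of `l`, with the top side last;
        -- `triMatrix_rotate` brings the triangles into this order.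
        · have h := mutate_triMatrix (k := k) (o := l.root) (a := r₁.root) (b := r₂.root) (c := o)
            (fun h => hkl (mem_labels_of_root h)) (fun h => hr.1 (.inl (mem_labels_of_root h)))
            (fun h => hr.1 (.inr (mem_labels_of_root h))) hok
            (fun i h h' => hlr i (mem_labels_of_root h) i
              (by simp [labels, mem_labels_of_root h']) rfl)
            (fun i h h' => hlr i (mem_labels_of_root h) i
              (by simp [labels, mem_labels_of_root h']) rfl)
            (fun i h h' => ho i h' i (.inl (mem_labels_of_root h)) rfl)
            (fun i h h' => hr.2.2.2 i (mem_labels_of_root h) i (mem_labels_of_root h') rfl)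
            (fun i h h' => ho i h' i (.inr (by simp [labels, mem_labels_of_root h])) rfl)
            (fun i h h' => ho i h' i (.inr (by simp [labels, mem_labels_of_root h])) rfl)
          have h2 : ∀ i, (l.mat + r₁.mat + r₂.mat) i k = 0 ∧ (l.mat + r₁.mat + r₂.mat) k i = 0 := by
            intro i
            simp [mat_eq_zero fun h => hr.1 (.inl h),
              mat_eq_zero fun h => hr.1 (.inr h), mat_eq_zero hkl]
          have h3 := mutate_add (B := triMatrix l.root (some k) o +
            triMatrix (some k) r₁.root r₂.root) h2
          rw [h] at h3
          simp only [topMatrix, mat, root_node]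
          rw [show triMatrix o l.root (some k) + l.mat + (triMatrix (some k) r₁.root r₂.root +
            r₁.mat + r₂.mat) = triMatrix l.root (some k) o +
            triMatrix (some k) r₁.root r₂.root + (l.mat + r₁.mat + r₂.mat) by
              rw [triMatrix_rotate o]; abel, h3, triMatrix_rotate (some k) r₂.root,
              triMatrix_rotate r₂.root, triMatrix_rotate (some k) l.root]
          abel
      · have hk' : k ∈ r₁.labels ++ r₂.labels := by
          simpa [labels, hka] using hkr
        obtain ⟨r₁', r₂', hp, hm⟩ := exists_topMatrix_eq_mutate k r₁ r₂ (some a)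
          (by simp only [Option.toList_some, List.cons_append, List.nil_append, List.nodup_cons,
                List.nodup_append, List.mem_append]
              exact hr) hk'
        refine ⟨l, node a r₁' r₂', ?_, ?_⟩
        · simp only [labels]
          exact (hp.cons _).append_left _
        · have hN : ∀ i, (triMatrix o l.root (some a) + l.mat) i k = 0 ∧
              (triMatrix o l.root (some a) + l.mat) k i = 0 := by
            intro i
            have h1 := ind_of_ne hok
            have h2 : ind (some a) k = 0 := ind_of_ne (by simpa using Ne.symm hka)
            have h3 : ind l.root k = 0 := ind_of_ne fun h => hkl (mem_labels_of_root h)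
            simp [triMatrix_apply, h1, h2, h3, mat_eq_zero hkl]
          have h3 := mutate_add (B := topMatrix (some a) r₁ r₂) hN
          rw [← hm] at h3
          have e (u v : PlaneTree ι) : topMatrix o l (node a u v) = topMatrix (some a) u v +
              (triMatrix o l.root (some a) + l.mat) := by
            simp only [topMatrix, mat, root_node]; abel
          rw [e, e, h3]
termination_by sizeOf l + sizeOf r

/-- The matrix is that of a triangulation whose diagonals are labelled by `ι`. -/
def IsTreeMatrix (B : Matrix ι ι ℤ) : Prop :=
  ∃ l r : PlaneTree ι, (l.labels ++ r.labels).Nodup ∧ (∀ k, k ∈ l.labels ++ r.labels) ∧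
    B = topMatrix none l r

lemma IsTreeMatrix.mutate {B : Matrix ι ι ℤ} (h : IsTreeMatrix B) (k : ι) :
    IsTreeMatrix (mutate k B) := by
  obtain ⟨l, r, hn, hk, rfl⟩ := h
  obtain ⟨l', r', hp, hm⟩ := exists_topMatrix_eq_mutate k l r none (by simpa using hn) (hk k)
  exact ⟨l', r', hp.nodup_iff.2 hn, fun i => hp.mem_iff.2 (hk i), hm.symm⟩

lemma IsTreeMatrix.of_mutationEquivalent {B C : Matrix ι ι ℤ} (h : IsTreeMatrix B)
    (e : MutationEquivalent B C) : IsTreeMatrix C := by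
  induction e with
  | refl => exact h
  | tail _ hs ih =>
    obtain ⟨k, rfl⟩ := hs
    exact ih.mutate k

/-- The tree has left children only, so each triangle has sides `k`, `k + 1` and a boundary side and
gives the arrow `k → k + 1`. The induction adds labels downwards from `n - 1`. -/
lemma exists_linear_tree (n m k : ℕ) (h : k + m = n) : ∃ t : PlaneTree (Fin n),
    t.labels.Nodup ∧ (∀ i, i ∈ t.labels ↔ k ≤ (i : ℕ)) ∧ (∀ i, t.root = some i ↔ (i : ℕ) = k) ∧
    ∀ i j, t.mat i j = if k ≤ (i : ℕ) ∧ k ≤ (j : ℕ) then matrixA n i j else 0 := by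
  induction m generalizing k with
  | zero =>
    refine ⟨leaf, by simp [labels], fun i => ?_, fun i => ?_, fun i j => ?_⟩
    · simp [labels]; omega
    · simp [root]; omega
    · rw [if_neg (by omega)]; rfl
  | succ m ih =>
    obtain ⟨t, hn, hm, hr, ht⟩ := ih (k + 1) (by omega)
    have hk : k < n := by omega
    refine ⟨node ⟨k, hk⟩ t leaf, ?_, fun i => ?_, fun i => ?_, fun i j => ?_⟩
    · simp [labels, hn, hm]
    · simp [labels, hm, Fin.ext_iff]; omega
    · simp [root, Fin.ext_iff]; omega
    · simp only [mat, Matrix.add_apply, Matrix.zero_apply, triMatrix_apply, root_leaf, ht, ind, hr,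
        Option.some.injEq, Fin.ext_iff, matrixA, reduceCtorEq, if_false]
      split_ifs <;> omega

lemma isTreeMatrix_matrixA (n : ℕ) : IsTreeMatrix (matrixA n) := by
  obtain ⟨t, hn, hm, -, ht⟩ := exists_linear_tree n n 0 (by omega)
  refine ⟨t, leaf, by simpa [labels] using hn, by simp [labels, hm], ?_⟩
  ext i j
  simp [topMatrix, mat, root, triMatrix_apply, ht]

/-- Relabelling of a tree. -/
def map {κ : Type*} (f : ι → κ) : PlaneTree ι → PlaneTree κ
  | leaf => leaf
  | node k l r => node (f k) (l.map f) (r.map f)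

omit [DecidableEq ι] in
lemma root_map {κ : Type*} (f : ι → κ) (t : PlaneTree ι) : (t.map f).root = t.root.map f := by
  cases t <;> rfl

omit [DecidableEq ι] in
lemma labels_map {κ : Type*} (f : ι → κ) (t : PlaneTree ι) :
    (t.map f).labels = t.labels.map f := by
  induction t with
  | leaf => rfl
  | node k l r hl hr => simp [map, labels, hl, hr]

lemma triMatrix_map {κ : Type*} [DecidableEq κ] (f : ι ≃ κ) (o a b : Option ι) :
    (triMatrix (o.map f) (a.map f) (b.map f)).submatrix f f = triMatrix o a b := by
  have h (o : Option ι) (i : ι) : ind (o.map f) (f i) = ind o i := by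
    cases o <;> simp [ind]
  ext i j
  simp [triMatrix_apply, h]

lemma mat_map {κ : Type*} [DecidableEq κ] (f : ι ≃ κ) (t : PlaneTree ι) :
    (t.map f).mat.submatrix f f = t.mat := by
  induction t with
  | leaf => rfl
  | node k l r hl hr =>
    have := triMatrix_map f (some k) l.root r.root
    simp only [map, mat, root_map, ← this, ← hl, ← hr]
    rfl

lemma IsTreeMatrix.of_submatrix {κ : Type*} [DecidableEq κ] (f : ι ≃ κ) {B : Matrix κ κ ℤ}
    (h : IsTreeMatrix (B.submatrix f f)) : IsTreeMatrix B := by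
  obtain ⟨l, r, hn, hk, h⟩ := h
  refine ⟨l.map f, r.map f, ?_, fun k => ?_, ?_⟩
  · rw [labels_map, labels_map, ← List.map_append]
    exact hn.map f.injective
  · rw [labels_map, labels_map, ← List.map_append]
    exact List.mem_map.2 ⟨f.symm k, hk _, by simp⟩
  · have e : (topMatrix none (l.map f) (r.map f)).submatrix f f = topMatrix none l r := by
      have := triMatrix_map f none l.root r.root
      rw [topMatrix, topMatrix, root_map, root_map, ← mat_map f l, ← mat_map f r, ← this]
      rfl
    rw [← e] at h
    ext i j
    simpa using congrFun (congrFun h (f.symm i)) (f.symm j)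

theorem isTreeMatrix_of_isTypeA {Q : FinQuiver} (h : Q.IsTypeA) :
    IsTreeMatrix Q.exchangeMatrix := by
  obtain ⟨-, -, n, e, -, h⟩ := h
  exact ((isTreeMatrix_matrixA n).of_mutationEquivalent h).of_submatrix e

/-! ### Arrows are exactly the consecutive pairs of sides -/

lemma triMatrix_pos {o a b : Option ι} {i j : ι} (h : 0 < triMatrix o a b i j) :
    TriPair o a b i j := by
  by_contra hc
  unfold TriPair at hc
  push Not at hc
  have key (o a : Option ι) (h : o = some i → a ≠ some j) : ind o i * ind a j = 0 := by
    by_cases e : o = some i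
    · rw [ind_of_ne (h e), mul_zero]
    · rw [ind_of_ne e, zero_mul]
  have hnn (o a : Option ι) : 0 ≤ ind o j * ind a i := by
    unfold ind; positivity
  rw [triMatrix_apply, key _ _ hc.1, key _ _ hc.2.1, key _ _ hc.2.2] at h
  linarith [hnn o a, hnn a b, hnn b o]

lemma mat_pos {t : PlaneTree ι} {i j : ι} (h : 0 < t.mat i j) : t.Pair i j := by
  induction t with
  | leaf => simp [mat] at h
  | node k l r hl hr =>
    by_contra hc
    simp only [Pair, not_or] at hc
    have h1 := mt triMatrix_pos hc.1
    have h2 := mt hl hc.2.1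
    have h3 := mt hr hc.2.2
    simp only [mat, Matrix.add_apply] at h
    linarith

lemma topMatrix_pos {o : Option ι} {l r : PlaneTree ι} {i j : ι} (h : 0 < topMatrix o l r i j) :
    TopPair o l r i j := by
  by_contra hc
  simp only [TopPair, not_or] at hc
  have h1 := mt triMatrix_pos hc.1
  have h2 := mt mat_pos hc.2.1
  have h3 := mt mat_pos hc.2.2
  simp only [topMatrix, Matrix.add_apply] at h
  linarith

/-- The conditions on the labels of a triangulation, in terms of the top triangle. -/
structure Admissible (o : Option ι) (l r : PlaneTree ι) : Prop where
  left : ∀ i, o = some i → i ∉ l.labels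
  right : ∀ i, o = some i → i ∉ r.labels
  disjoint : ∀ i, i ∈ l.labels → i ∉ r.labels
  nodup_left : l.labels.Nodup
  nodup_right : r.labels.Nodup

omit [DecidableEq ι] in
lemma admissible_of_nodup {k : ι} {l r : PlaneTree ι} (h : (node k l r).labels.Nodup) :
    Admissible (some k) l r := by
  simp only [labels, List.nodup_cons, List.nodup_append, List.mem_append, not_or] at h
  refine ⟨?_, ?_, fun i hi hi' => h.2.2.2 i hi i hi' rfl, h.2.1, h.2.2.1⟩
  · rintro i ⟨⟩; exact h.1.1
  · rintro i ⟨⟩; exact h.1.2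

lemma triMatrix_eq_one {o a b : Option ι} (hoa : ∀ i, o = some i → a ≠ some i)
    (hob : ∀ i, o = some i → b ≠ some i) (hab : ∀ i, a = some i → b ≠ some i) {i j : ι}
    (h : TriPair o a b i j) : triMatrix o a b i j = 1 := by
  have key (o a b : Option ι) (hoa : ∀ i, o = some i → a ≠ some i)
      (hob : ∀ i, o = some i → b ≠ some i) (hab : ∀ i, a = some i → b ≠ some i)
      (h1 : o = some i) (h2 : a = some j) : triMatrix o a b i j = 1 := by
    rw [triMatrix_apply, ind_of_eq h1, ind_of_eq h2, ind_of_ne (hoa i h1), ind_of_ne (hob i h1),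
      ind_of_ne (hab j h2), ind_of_ne fun h => hoa j h h2]
    ring
  rcases h with ⟨h1, h2⟩ | ⟨h1, h2⟩ | ⟨h1, h2⟩
  · exact key o a b hoa hob hab h1 h2
  · rw [triMatrix_rotate]
    exact key a b o hab (fun i h h' => hoa i h' h) (fun i h h' => hob i h' h) h1 h2
  · rw [triMatrix_rotate, triMatrix_rotate]
    exact key b o a (fun i h h' => hob i h' h) (fun i h h' => hab i h' h) hoa h1 h2

/-- Two different triangles share at most one side, so a pair of sides occurs in only one triangle
and no other term alters its entry. -/
lemma topMatrix_eq_one_of {o : Option ι} {l r : PlaneTree ι} (h : Admissible o l r)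
    (hl : ∀ i j, l.Pair i j → l.mat i j = 1) (hr : ∀ i j, r.Pair i j → r.mat i j = 1) {i j : ι}
    (hij : TopPair o l r i j) : topMatrix o l r i j = 1 := by
  have hol {i : ι} (hi : i ∈ l.labels) : o ≠ some i := fun h' => h.left i h' hi
  have hor {i : ι} (hi : i ∈ r.labels) : o ≠ some i := fun h' => h.right i h' hi
  have hrl {i : ι} (hi : i ∈ l.labels) : r.root ≠ some i := fun h' =>
    h.disjoint i hi (mem_labels_of_root h')
  have hlr {i : ι} (hi : i ∈ r.labels) : l.root ≠ some i := fun h' =>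
    h.disjoint i (mem_labels_of_root h') hi
  simp only [topMatrix, Matrix.add_apply]
  rcases hij with hij | hij | hij
  · rw [triMatrix_eq_one (fun i h' h'' => h.left i h' (mem_labels_of_root h''))
      (fun i h' h'' => h.right i h' (mem_labels_of_root h''))
      (fun i h' => hrl (mem_labels_of_root h')) hij]
    have h1 : l.mat i j = 0 := by
      rcases hij with ⟨h1, h2⟩ | ⟨h1, h2⟩ | ⟨h1, h2⟩
      · exact (mat_eq_zero (h.left _ h1) _).1
      · exact (mat_eq_zero (fun h' => hrl h' h2) _).2
      · exact (mat_eq_zero (h.left _ h2) _).2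
    have h2 : r.mat i j = 0 := by
      rcases hij with ⟨h1, h2⟩ | ⟨h1, h2⟩ | ⟨h1, h2⟩
      · exact (mat_eq_zero (h.right _ h1) _).1
      · exact (mat_eq_zero (fun h' => hlr h' h1) _).1
      · exact (mat_eq_zero (h.right _ h2) _).2
    rw [h1, h2]; rfl
  · obtain ⟨hi, hj⟩ := hij.mem
    rw [hl i j hij, (mat_eq_zero (h.disjoint _ hi) _).1, triMatrix_apply, ind_of_ne (hol hi),
      ind_of_ne (hol hj), ind_of_ne (hrl hi), ind_of_ne (hrl hj)]
    ring
  · obtain ⟨hi, hj⟩ := hij.mem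
    rw [hr i j hij, (mat_eq_zero (fun h' => h.disjoint _ h' hi) _).1, triMatrix_apply,
      ind_of_ne (hor hi), ind_of_ne (hor hj), ind_of_ne (hlr hi), ind_of_ne (hlr hj)]
    ring

lemma mat_eq_one {t : PlaneTree ι} (h : t.labels.Nodup) {i j : ι} (hij : t.Pair i j) :
    t.mat i j = 1 := by
  induction t generalizing i j with
  | leaf => exact hij.elim
  | node k l r hl hr =>
    have h' := admissible_of_nodup h
    exact topMatrix_eq_one_of h' (fun _ _ => hl h'.nodup_left) (fun _ _ => hr h'.nodup_right) hij

lemma topMatrix_eq_one {o : Option ι} {l r : PlaneTree ι} (h : Admissible o l r) {i j : ι}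
    (hij : TopPair o l r i j) : topMatrix o l r i j = 1 :=
  topMatrix_eq_one_of h (fun _ _ => mat_eq_one h.nodup_left) (fun _ _ => mat_eq_one h.nodup_right)
    hij

end PlaneTree

/-! ### Cluster-tilted algebras of type `A` -/

open PlaneTree

/-- The relations of a quiver without loops and 2-cycles are that the products of consecutive
arrows of oriented triangles vanish. -/
structure BoundQuiver.IsTriangular (Q : BoundQuiver) : Prop where
  src_ne_tgt : ∀ a : Q.E, Q.src a ≠ Q.tgt a
  not_two_cycle : ∀ a b : Q.E, ¬ (Q.tgt a = Q.src b ∧ Q.tgt b = Q.src a)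
  comm : Q.commRel = ∅
  zero : ∀ p, p ∈ Q.zeroRel ↔ ∃ a b c, Q.IsTriangle a b c ∧ p = [a, b]

namespace BoundQuiver

variable {Q : BoundQuiver} {X Y : Set Q.E}

/-- Triangles with an arrow in `X` are contained in `X`. -/
def TriangleClosed (Q : BoundQuiver) (X : Set Q.E) : Prop :=
  ∀ a b c, Q.IsTriangle a b c → a ∈ X → b ∈ X

/-- The triangles of `X`. -/
def triangleSet (Q : BoundQuiver) (X : Set Q.E) : Set (Finset Q.E) :=
  {T | ∃ a b c, Q.IsTriangle a b c ∧ a ∈ X ∧ T = {a, b, c}}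

lemma isTriangle_rotate {a b c : Q.E} (h : Q.IsTriangle a b c) : Q.IsTriangle b c a :=
  ⟨h.2.1, h.2.2, h.1⟩

/-- The algebra of the quiver with arrows `X` has determinant `2 ^ t`. -/
def HasTriangleDet (Q : BoundQuiver) (X : Set Q.E) : Prop :=
  Q.HasThinDet X (2 ^ (Q.triangleSet X).ncard)

namespace IsTriangular

variable (hQ : Q.IsTriangular)
include hQ

/-- A triangle with arrows in both sets would pass between them at two of its vertices. Both would
equal `r`, forcing a loop. -/
lemma triangleClosed_of_union {r : Q.V} (hd : ∀ v, Q.Touches X v → Q.Touches Y v → v = r)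
    (h : Q.TriangleClosed (X ∪ Y)) : Q.TriangleClosed X := by
  intro a b c ht ha
  have hb := h a b c ht (Or.inl ha)
  have hc := h b c a (isTriangle_rotate ht) hb
  by_contra hbX
  have hb := hb.resolve_left hbX
  have e1 : Q.src b = r := hd _ (ht.1 ▸ touches_tgt ha) (touches_src hb)
  rcases hc with hc | hc
  · have e2 : Q.tgt b = r := hd _ (ht.2.1 ▸ touches_src hc) (touches_tgt hb)
    exact hQ.src_ne_tgt b (e1.trans e2.symm)
  · have e2 : Q.src a = r := hd _ (touches_src ha) (ht.2.2 ▸ touches_tgt hc)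
    exact hQ.src_ne_tgt a (e2.trans (e1.symm.trans ht.1.symm))

lemma separated {r : Q.V} (hXY : ∀ a, a ∈ X → a ∉ Y)
    (hd : ∀ v, Q.Touches X v → Q.Touches Y v → v = r) (hX : Q.TriangleClosed X)
    (hY : Q.TriangleClosed Y) : Q.Separated X Y r where
  disjoint := hXY
  eq_of_touches := hd
  zero := by
    intro p hp h
    obtain ⟨a, b, c, ht, rfl⟩ := (hQ.zero p).1 hp
    rcases h a (by simp) with ha | ha
    · left
      simp [ha, hX a b c ht ha]
    · right
      simp [ha, hY a b c ht ha]
  comm := by simp [hQ.comm]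

-- Closedness puts all arrows of a triangle starting in `Y` into `Y`, so no triangle is counted on
-- both sides.
omit hQ in
lemma ncard_triangleSet_union (hXY : ∀ a, a ∈ X → a ∉ Y) (hY : Q.TriangleClosed Y) :
    (Q.triangleSet (X ∪ Y)).ncard = (Q.triangleSet X).ncard + (Q.triangleSet Y).ncard := by
  rw [← Set.ncard_union_eq]
  · congr 1
    ext T
    constructor
    · rintro ⟨a, b, c, ht, ha | ha, rfl⟩
      · exact Or.inl ⟨a, b, c, ht, ha, rfl⟩
      · exact Or.inr ⟨a, b, c, ht, ha, rfl⟩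
    · rintro (⟨a, b, c, ht, ha, rfl⟩ | ⟨a, b, c, ht, ha, rfl⟩)
      · exact ⟨a, b, c, ht, Or.inl ha, rfl⟩
      · exact ⟨a, b, c, ht, Or.inr ha, rfl⟩
  · rw [Set.disjoint_left]
    rintro _ ⟨a, b, c, ht, ha, rfl⟩ ⟨a', b', c', ht', ha', e⟩
    have h1 : a ∈ ({a', b', c'} : Finset Q.E) := e ▸ (by simp)
    have hb' := hY _ _ _ ht' ha'
    have hc' := hY _ _ _ (isTriangle_rotate ht') hb'
    simp only [Finset.mem_insert, Finset.mem_singleton] at h1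
    apply hXY a ha
    rcases h1 with rfl | rfl | rfl <;> assumption

/-- Closedness under triangles descends from the union to its parts. The determinants of the parts
are therefore only required conditionally on it, which suits the recursion over a tree. -/
lemma hasTriangleDet_union {r : Q.V} (hXY : ∀ a, a ∈ X → a ∉ Y)
    (hd : ∀ v, Q.Touches X v → Q.Touches Y v → v = r) (h : Q.TriangleClosed (X ∪ Y))
    (hX : Q.TriangleClosed X → Q.HasTriangleDet X)
    (hY : Q.TriangleClosed Y → Q.HasTriangleDet Y) : Q.HasTriangleDet (X ∪ Y) := by
  have cX := hQ.triangleClosed_of_union hd h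
  have cY := hQ.triangleClosed_of_union (fun v h h' => hd v h' h) (Set.union_comm X Y ▸ h)
  rw [HasTriangleDet, ncard_triangleSet_union hXY cY, pow_add]
  exact (hX cX).union (hY cY) (hQ.separated hXY hd cX cY)

/-! ### The blocks: no arrow, one arrow, one oriented triangle -/

lemma hasTriangleDet_empty : Q.HasTriangleDet ∅ := by
  have : Q.triangleSet ∅ = ∅ := by
    ext T; simp [triangleSet]
  rw [HasTriangleDet, this, Set.ncard_empty, pow_zero]
  refine hasThinDet_empty (fun h => ?_) (by simp [hQ.comm])
  obtain ⟨a, b, c, _, h⟩ := (hQ.zero _).1 h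
  simp at h

open Classical in
/-- The paths from `x` if any two consecutive arrows in `X` have product zero. -/
noncomputable def thinAt (x : Q.V)
    (hu : ∀ a ∈ X, ∀ b ∈ X, Q.src a = Q.src b → Q.tgt a = Q.tgt b → a = b)
    (hz : ∀ a ∈ X, ∀ b ∈ X, Q.tgt a = Q.src b → [a, b] ∈ Q.zeroRel) : ThinAt Q X x := by
  let g : Q.V → List Q.E := fun y =>
    if h : ∃ a ∈ X, Q.src a = x ∧ Q.tgt a = y then [h.choose] else []
  have hg {a : Q.E} (ha : a ∈ X) (hx : Q.src a = x) : g (Q.tgt a) = [a] := by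
    have h : ∃ b ∈ X, Q.src b = x ∧ Q.tgt b = Q.tgt a := ⟨a, ha, hx, rfl⟩
    simp only [g]
    rw [dif_pos h, List.cons.injEq]
    exact ⟨hu _ h.choose_spec.1 _ ha (h.choose_spec.2.1.trans hx.symm) h.choose_spec.2.2, rfl⟩
  have hgx : g x = [] := by
    refine dif_neg ?_
    rintro ⟨a, _, h, h'⟩
    exact hQ.src_ne_tgt a (h.trans h'.symm)
  exact
  { F a := a ∈ X ∧ Q.src a = x
    d y := y = x ∨ ∃ a ∈ X, Q.src a = x ∧ Q.tgt a = y
    g := g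
    d_self := Or.inl rfl
    g_self := hgx
    mem_of_F h := h.1
    d_src h := Or.inl h.2
    d_tgt h := Or.inr ⟨_, h.1, h.2, rfl⟩
    tgt_ne h e := hQ.src_ne_tgt _ (h.2.trans e.symm)
    pathEq := by
      rintro a ⟨ha, hx⟩
      rw [hg ha hx, hx, hgx]
      exact .refl _
    isNull := by
      intro a ha hd hF
      rcases hd with hd | ⟨b, hb, hbx, hba⟩
      · exact absurd ⟨ha, hd⟩ hF
      · rw [← hba, hg hb hbx]
        exact IsNull.of_mem (hz b hb a ha hba) [] []
    walk := by
      rintro y (rfl | ⟨a, ha, hx, rfl⟩)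
      · rw [hgx]; rfl
      · rw [hg ha hx]; exact ⟨hx, ⟨ha, hx⟩, rfl⟩
    zero := by
      intro p hp _ y z w
      obtain ⟨a, b, c, ht, rfl⟩ := (hQ.zero p).1 hp
      exact hQ.src_ne_tgt a (w.2.1.2.trans (ht.1.trans w.2.2.2.1.2).symm)
    comm := by simp [hQ.comm] }

omit hQ in
open Classical in
/-- The Cartan matrix if any two consecutive arrows in `X` have product zero. -/
noncomputable def _root_.ClusterTilted.BoundQuiver.consecutiveMatrix (Q : BoundQuiver)
    (X : Set Q.E) : Matrix Q.V Q.V ℤ :=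
  fun x y => if y = x ∨ ∃ a ∈ X, Q.src a = x ∧ Q.tgt a = y then 1 else 0

lemma hasThinDet_of_consecutive
    (hu : ∀ a ∈ X, ∀ b ∈ X, Q.src a = Q.src b → Q.tgt a = Q.tgt b → a = b)
    (hz : ∀ a ∈ X, ∀ b ∈ X, Q.tgt a = Q.src b → [a, b] ∈ Q.zeroRel) :
    Q.HasThinDet X (Q.consecutiveMatrix X).det :=
  ⟨fun x => hQ.thinAt x hu hz, by
    congr 1
    ext x y
    simp only [thinMatrix, consecutiveMatrix, thinAt]
    congr⟩

/-- A single arrow. -/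
lemma hasTriangleDet_singleton (a : Q.E) (h : Q.TriangleClosed {a}) :
    Q.HasTriangleDet {a} := by
  have hne := hQ.src_ne_tgt a
  have : Q.triangleSet {a} = ∅ := by
    ext T
    simp only [Set.mem_empty_iff_false, iff_false]
    rintro ⟨b, c, d, ht, rfl, -⟩
    obtain rfl : c = b := h b c d ht rfl
    exact hne ht.1.symm
  -- The arrow adds a single off-diagonal entry to the identity.
  have hdet : (Q.consecutiveMatrix {a}).det = 1 := by
    rw [← Matrix.det_transvection_of_ne (R := ℤ) _ _ hne 1]
    congr 1
    ext x y
    simp only [consecutiveMatrix, Matrix.transvection, Matrix.add_apply, Matrix.one_apply,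
      Matrix.single_apply, Set.mem_singleton_iff, exists_eq_left]
    by_cases h1 : x = y
    · subst h1
      rw [if_pos rfl, if_pos (Or.inl rfl), if_neg, add_zero]
      rintro ⟨h1, h2⟩
      exact hne (h1.trans h2.symm)
    · simp [h1, Ne.symm h1]
  rw [HasTriangleDet, this, Set.ncard_empty, pow_zero, ← hdet]
  refine hQ.hasThinDet_of_consecutive (by rintro b rfl c rfl _ _; rfl) ?_
  rintro b rfl c rfl h
  exact absurd h.symm hne

/-- An oriented triangle. -/
lemma hasTriangleDet_triangle {a b c : Q.E} (ht : Q.IsTriangle a b c)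
    (h : Q.TriangleClosed {a, b, c}) : Q.HasTriangleDet {a, b, c} := by
  have hab := hQ.src_ne_tgt a
  have hbc := hQ.src_ne_tgt b
  have hca := hQ.src_ne_tgt c
  obtain ⟨h1, h2, h3⟩ := ht
  have n1 : Q.src a ≠ Q.src b := h1 ▸ hab
  have n2 : Q.src b ≠ Q.src c := h2 ▸ hbc
  have n3 : Q.src c ≠ Q.src a := h3 ▸ hca
  have hnext : ∀ x ∈ ({a, b, c} : Set Q.E), ∀ y ∈ ({a, b, c} : Set Q.E), Q.tgt x = Q.src y →
      (x = a ∧ y = b) ∨ (x = b ∧ y = c) ∨ (x = c ∧ y = a) := by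
    intro x hx y hy hxy
    simp only [Set.mem_insert_iff, Set.mem_singleton_iff] at hx hy
    rcases hx with rfl | rfl | rfl <;> rcases hy with rfl | rfl | rfl <;> simp_all
  have : Q.triangleSet {a, b, c} = {{a, b, c}} := by
    ext T
    simp only [Set.mem_singleton_iff]
    constructor
    · rintro ⟨x, y, z, ht, hx, rfl⟩
      have hy := h x y z ht hx
      have hz := h y z x (isTriangle_rotate ht) hy
      have hxy := hnext x hx y hy ht.1
      have hyz := hnext y hy z hz ht.2.1
      have hab : a ≠ b := fun e => n1 (e ▸ rfl)
      have hbc : b ≠ c := fun e => n2 (e ▸ rfl)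
      have hca : c ≠ a := fun e => n3 (e ▸ rfl)
      rcases hxy with ⟨rfl, rfl⟩ | ⟨rfl, rfl⟩ | ⟨rfl, rfl⟩ <;>
        rcases hyz with ⟨e, rfl⟩ | ⟨e, rfl⟩ | ⟨e, rfl⟩ <;>
        first
        | exact absurd e hab.symm
        | exact absurd e hbc.symm
        | exact absurd e hca.symm
        | exact absurd e hab
        | exact absurd e hbc
        | exact absurd e hca
        | (ext; simp only [Finset.mem_insert, Finset.mem_singleton] <;> tauto)
    · rintro rfl
      exact ⟨a, b, c, ⟨h1, h2, h3⟩, by simp, rfl⟩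
  -- On the three vertices the matrix is the circulant with rows `110`, `011`, `101`, of determinant
  -- `1 + 1`.
  have hdet : (Q.consecutiveMatrix {a, b, c}).det = 2 := by
    rw [det_eq_det_submatrix (f := ![Q.src a, Q.src b, Q.src c])]
    · rw [Matrix.det_fin_three]
      simp [consecutiveMatrix, h1, h2, h3, n1, n2, n3, n1.symm, n2.symm, n3.symm]
    · intro i j
      fin_cases i <;> fin_cases j <;> simp [n1, n2, n3, n1.symm, n2.symm, n3.symm]
    · intro x y h
      simp only [consecutiveMatrix]
      congr 1
      refine propext ⟨fun h' => h'.elim Eq.symm fun ⟨e, he, hx, hy⟩ => ?_, fun h => Or.inl h.symm⟩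
      subst hx hy
      exfalso
      simp only [Set.mem_insert_iff, Set.mem_singleton_iff] at he
      rcases he with rfl | rfl | rfl <;> simp [h1, h2, h3] at h
  rw [HasTriangleDet, this, Set.ncard_singleton, pow_one, ← hdet]
  refine hQ.hasThinDet_of_consecutive ?_ ?_
  · intro x hx y hy h _
    simp only [Set.mem_insert_iff, Set.mem_singleton_iff] at hx hy
    rcases hx with rfl | rfl | rfl <;> rcases hy with rfl | rfl | rfl <;> simp_all
  · intro x hx y hy h
    rw [hQ.zero]
    rcases hnext x hx y hy h with ⟨rfl, rfl⟩ | ⟨rfl, rfl⟩ | ⟨rfl, rfl⟩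
    · exact ⟨_, _, c, ⟨h1, h2, h3⟩, rfl⟩
    · exact ⟨_, _, a, ⟨h2, h3, h1⟩, rfl⟩
    · exact ⟨_, _, b, ⟨h3, h1, h2⟩, rfl⟩

/-! ### Decomposing a triangulation into blocks -/

/-- The arrows along the sides of a triangle. -/
def _root_.ClusterTilted.BoundQuiver.triArrows (Q : BoundQuiver) (o a b : Option Q.V) : Set Q.E :=
  {e | TriPair o a b (Q.src e) (Q.tgt e)}

/-- The arrows along the sides of the triangles of a tree. -/
def _root_.ClusterTilted.BoundQuiver.treeArrows (Q : BoundQuiver) (t : PlaneTree Q.V) : Set Q.E :=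
  {e | t.Pair (Q.src e) (Q.tgt e)}

/-- The arrows of a triangulation with top triangle `(o, l, r)`. -/
def _root_.ClusterTilted.BoundQuiver.topArrows (Q : BoundQuiver) (o : Option Q.V)
    (l r : PlaneTree Q.V) : Set Q.E :=
  {e | TopPair o l r (Q.src e) (Q.tgt e)}

/-- In the absence of 2-cycles the two counts in `exchangeMatrix` cannot both be positive, so the
entry is an honest number of arrows. -/
lemma exists_unique_arrow {i j : Q.V} (h : Q.exchangeMatrix i j = 1) :
    ∃ e, Q.src e = i ∧ Q.tgt e = j ∧ ∀ f, Q.src f = i → Q.tgt f = j → f = e := by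
  unfold FinQuiver.exchangeMatrix at h
  have h0 : (Finset.univ.filter fun a : Q.E => Q.src a = j ∧ Q.tgt a = i).card = 0 := by
    by_contra hne
    obtain ⟨f, hf⟩ := Finset.card_pos.1 (Nat.pos_of_ne_zero hne)
    have : 0 < (Finset.univ.filter fun a : Q.E => Q.src a = i ∧ Q.tgt a = j).card := by omega
    obtain ⟨e, he⟩ := Finset.card_pos.1 this
    simp only [Finset.mem_filter, Finset.mem_univ, true_and] at he hf
    exact hQ.not_two_cycle e f ⟨he.2.trans hf.1.symm, hf.2.trans he.1.symm⟩
  rw [h0] at h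
  have h1 : (Finset.univ.filter fun a : Q.E => Q.src a = i ∧ Q.tgt a = j).card = 1 := by omega
  obtain ⟨e, he⟩ := Finset.card_eq_one.1 h1
  have key (f : Q.E) : (Q.src f = i ∧ Q.tgt f = j) ↔ f = e := by
    simpa using Finset.ext_iff.1 he f
  exact ⟨e, ((key e).2 rfl).1, ((key e).2 rfl).2, fun f h h' => (key f).1 ⟨h, h'⟩⟩

/-- Boundary sides are `none`. With three, two or fewer diagonals among its sides, a triangle
contributes an oriented 3-cycle, a single arrow or nothing. -/
lemma hasTriangleDet_triArrows {o a b : Option Q.V}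
    (h : ∀ i j, TriPair o a b i j → Q.exchangeMatrix i j = 1)
    (hc : Q.TriangleClosed (Q.triArrows o a b)) : Q.HasTriangleDet (Q.triArrows o a b) := by
  have hsingle {i j : Q.V} (hij : TriPair o a b i j)
      (hu : ∀ i' j', TriPair o a b i' j' → i' = i ∧ j' = j) :
      Q.HasTriangleDet (Q.triArrows o a b) := by
    obtain ⟨e, rfl, rfl, he⟩ := hQ.exists_unique_arrow (h _ _ hij)
    have : Q.triArrows o a b = {e} := by
      ext f
      refine ⟨fun hf => he f (hu _ _ hf).1 (hu _ _ hf).2, ?_⟩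
      rintro rfl
      exact hij
    rw [this] at hc ⊢
    exact hQ.hasTriangleDet_singleton e hc
  have hempty (hn : ∀ i j, ¬ TriPair o a b i j) : Q.HasTriangleDet (Q.triArrows o a b) := by
    have : Q.triArrows o a b = ∅ := Set.eq_empty_of_forall_notMem fun e he => hn _ _ he
    rw [this]
    exact hQ.hasTriangleDet_empty
  rcases o with _ | i <;> rcases a with _ | j <;> rcases b with _ | k
  · exact hempty (by simp [TriPair])
  · exact hempty (by simp [TriPair])
  · exact hempty (by simp [TriPair])
  · exact hsingle (i := j) (j := k) (by simp [TriPair]) (by simp [TriPair, eq_comm])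
  · exact hempty (by simp [TriPair])
  · exact hsingle (i := k) (j := i) (by simp [TriPair]) (by simp [TriPair, eq_comm])
  · exact hsingle (i := i) (j := j) (by simp [TriPair]) (by simp [TriPair, eq_comm])
  · obtain ⟨e, e1, e2, he⟩ := hQ.exists_unique_arrow (h i j (by simp [TriPair]))
    obtain ⟨f, f1, f2, hf⟩ := hQ.exists_unique_arrow (h j k (by simp [TriPair]))
    obtain ⟨g, g1, g2, hg⟩ := hQ.exists_unique_arrow (h k i (by simp [TriPair]))
    have : Q.triArrows (some i) (some j) (some k) = {e, f, g} := by
      ext x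
      simp only [triArrows, TriPair, Set.mem_ofPred_eq, Option.some.injEq, Set.mem_insert_iff,
        Set.mem_singleton_iff]
      constructor
      · rintro (⟨h, h'⟩ | ⟨h, h'⟩ | ⟨h, h'⟩)
        · exact Or.inl (he x h.symm h'.symm)
        · exact Or.inr (Or.inl (hf x h.symm h'.symm))
        · exact Or.inr (Or.inr (hg x h.symm h'.symm))
      · rintro (rfl | rfl | rfl)
        · exact Or.inl ⟨e1.symm, e2.symm⟩
        · exact Or.inr (Or.inl ⟨f1.symm, f2.symm⟩)
        · exact Or.inr (Or.inr ⟨g1.symm, g2.symm⟩)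
    rw [this] at hc ⊢
    exact hQ.hasTriangleDet_triangle ⟨e2.trans f1.symm, f2.trans g1.symm, g2.trans e1.symm⟩ hc

omit hQ in
lemma mem_of_touches_triArrows {o a b : Option Q.V} {v : Q.V}
    (h : Q.Touches (Q.triArrows o a b) v) : o = some v ∨ a = some v ∨ b = some v := by
  obtain ⟨e, he, rfl | rfl⟩ := h <;> rcases he with ⟨h1, h2⟩ | ⟨h1, h2⟩ | ⟨h1, h2⟩ <;> simp [h1, h2]

omit hQ in
lemma mem_of_touches_treeArrows {t : PlaneTree Q.V} {v : Q.V}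
    (h : Q.Touches (Q.treeArrows t) v) : v ∈ t.labels := by
  obtain ⟨e, he, rfl | rfl⟩ := h
  · exact he.mem.1
  · exact he.mem.2

/-- The subtree shares only its root diagonal with `X`. A leaf is a boundary side and carries no
arrow, so nothing is attached. -/
lemma hasTriangleDet_attach {t : PlaneTree Q.V}
    (ht : Q.TriangleClosed (Q.treeArrows t) → Q.HasTriangleDet (Q.treeArrows t))
    (hX : Q.TriangleClosed X → Q.HasTriangleDet X)
    (hd : ∀ v, Q.Touches X v → v ∈ t.labels → t.root = some v)
    (hc : Q.TriangleClosed (X ∪ Q.treeArrows t)) : Q.HasTriangleDet (X ∪ Q.treeArrows t) := by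
  cases t with
  | leaf =>
    have : Q.treeArrows leaf = ∅ := rfl
    rw [this, Set.union_empty] at hc ⊢
    exact hX hc
  | node k l r =>
    have hd' : ∀ v, Q.Touches X v → Q.Touches (Q.treeArrows (node k l r)) v → v = k :=
      fun v h h' => by simpa [eq_comm] using hd v h (mem_of_touches_treeArrows h')
    refine hQ.hasTriangleDet_union (r := k) (fun a ha ha' => ?_) hd' hc hX ht
    have h1 := hd' _ (touches_src ha) (touches_src ha')
    have h2 := hd' _ (touches_tgt ha) (touches_tgt ha')
    exact hQ.src_ne_tgt a (h1.trans h2.symm)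

lemma hasTriangleDet_topArrows_of {o : Option Q.V} {l r : PlaneTree Q.V} (h : Admissible o l r)
    (hB : ∀ i j, TopPair o l r i j → Q.exchangeMatrix i j = 1)
    (hl : Q.TriangleClosed (Q.treeArrows l) → Q.HasTriangleDet (Q.treeArrows l))
    (hr : Q.TriangleClosed (Q.treeArrows r) → Q.HasTriangleDet (Q.treeArrows r))
    (hc : Q.TriangleClosed (Q.topArrows o l r)) : Q.HasTriangleDet (Q.topArrows o l r) := by
  have e : Q.topArrows o l r =
      Q.triArrows o l.root r.root ∪ Q.treeArrows l ∪ Q.treeArrows r := by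
    ext x
    simp only [topArrows, PlaneTree.TopPair, triArrows, treeArrows, Set.mem_union, Set.mem_ofPred_eq, or_assoc]
  rw [e] at hc ⊢
  refine hQ.hasTriangleDet_attach hr (fun hc' => ?_) (fun v hv hvr => ?_) hc
  · refine hQ.hasTriangleDet_attach hl (fun hc'' => ?_) (fun v hv hvl => ?_) hc'
    · exact hQ.hasTriangleDet_triArrows (fun i j hij => hB i j (Or.inl hij)) hc''
    · rcases mem_of_touches_triArrows hv with h' | h' | h'
      · exact absurd hvl (h.left v h')
      · exact h'
      · exact absurd (mem_labels_of_root h') (h.disjoint v hvl)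
  · rcases hv.union with hv | hv
    · rcases mem_of_touches_triArrows hv with h' | h' | h'
      · exact absurd hvr (h.right v h')
      · exact absurd hvr (h.disjoint v (mem_labels_of_root h'))
      · exact h'
    · exact absurd hvr (h.disjoint v (mem_of_touches_treeArrows hv))

lemma hasTriangleDet_treeArrows {t : PlaneTree Q.V} (h : t.labels.Nodup)
    (hB : ∀ i j, t.Pair i j → Q.exchangeMatrix i j = 1)
    (hc : Q.TriangleClosed (Q.treeArrows t)) : Q.HasTriangleDet (Q.treeArrows t) := by
  induction t with
  | leaf => exact hQ.hasTriangleDet_empty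
  | node k l r hl hr =>
    have h' := admissible_of_nodup h
    exact hQ.hasTriangleDet_topArrows_of h' hB
      (hl h'.nodup_left fun i j hij => hB i j (Or.inr (Or.inl hij)))
      (hr h'.nodup_right fun i j hij => hB i j (Or.inr (Or.inr hij))) hc

/-- An arrow makes its entry of the exchange matrix positive, hence runs between consecutive sides
of a triangle. So the triangulation accounts for all arrows. -/
theorem hasTriangleDet_univ (h : IsTreeMatrix Q.exchangeMatrix) :
    Q.HasTriangleDet Set.univ := by
  obtain ⟨l, r, hn, -, hB⟩ := h
  rw [List.nodup_append] at hn
  have hadm : Admissible none l r :=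
    ⟨by simp, by simp, fun i hi hi' => hn.2.2 i hi i hi' rfl, hn.1, hn.2.1⟩
  have hone : ∀ i j, TopPair none l r i j → Q.exchangeMatrix i j = 1 := fun i j hij => by
    rw [hB]; exact topMatrix_eq_one hadm hij
  have huniv : Q.topArrows none l r = Set.univ := by
    refine Set.eq_univ_of_forall fun e => topMatrix_pos ?_
    rw [← hB]
    unfold FinQuiver.exchangeMatrix
    have h0 : (Finset.univ.filter fun a : Q.E =>
        Q.src a = Q.tgt e ∧ Q.tgt a = Q.src e) = ∅ := by
      refine Finset.filter_eq_empty_iff.2 fun f _ hf => ?_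
      exact hQ.not_two_cycle e f ⟨hf.1.symm, hf.2⟩
    rw [h0, Finset.card_empty]
    have : 0 < (Finset.univ.filter fun a : Q.E =>
        Q.src a = Q.src e ∧ Q.tgt a = Q.tgt e).card :=
      Finset.card_pos.2 ⟨e, by simp⟩
    omega
  rw [← huniv]
  refine hQ.hasTriangleDet_topArrows_of hadm hone
    (hQ.hasTriangleDet_treeArrows hadm.nodup_left fun i j hij => hone i j (Or.inr (Or.inl hij)))
    (hQ.hasTriangleDet_treeArrows hadm.nodup_right fun i j hij => hone i j (Or.inr (Or.inr hij)))
    ?_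
  rw [huniv]
  exact fun _ _ _ _ _ => Set.mem_univ _

end IsTriangular

end BoundQuiver

lemma RootedTypeA.isTriangular (R : RootedTypeA) : R.bound.IsTriangular where
  src_ne_tgt := R.isTypeA.1
  not_two_cycle := R.isTypeA.2.1
  comm := rfl
  zero _ := Iff.rfl

theorem RootedTypeA.hasThinDet (R : RootedTypeA) :
    R.bound.HasThinDet Set.univ (2 ^ R.triangles) := by
  have h := R.isTriangular.hasTriangleDet_univ (PlaneTree.isTreeMatrix_of_isTypeA R.isTypeA)
  have e : R.bound.triangleSet Set.univ =
      {T : Finset R.E | ∃ a b c, R.IsTriangle a b c ∧ T = {a, b, c}} := by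
    ext T
    constructor
    · rintro ⟨a, b, c, h, -, e⟩
      exact ⟨a, b, c, h, e⟩
    · rintro ⟨a, b, c, h, e⟩
      exact ⟨a, b, c, h, trivial, e⟩
  unfold BoundQuiver.HasTriangleDet at h
  rw [e] at h
  exact h

/-! ### The skeletons with at most four vertices -/

/-- The Boolean version of `BoundQuiver.Walk`. -/
def walkB {n k : ℕ} (src tgt : Fin k → Fin n) (F : Fin k → Bool) :
    Fin n → List (Fin k) → Fin n → Bool
  | x, [], y => x = y
  | x, a :: p, y => src a = x && F a && walkB src tgt F (tgt a) p y

section Finite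

variable {n k : ℕ} {src tgt : Fin k → Fin n} {Z : Set (List (Fin k))}
  {C : Set (List (Fin k) × List (Fin k))}

/-- The Boolean form makes the conditions on the tables accessible to `decide`. -/
lemma walk_mkSkeleton {F : Fin k → Bool} {x y : Fin n} {p : List (Fin k)} :
    (mkSkeleton n k src tgt Z C).Walk (fun a => F a = true) x p y ↔
      walkB src tgt F x p y = true := by
  induction p generalizing x with
  | nil => simp [walkB]; rfl
  | cons a p ih =>
    have : (mkSkeleton n k src tgt Z C).Walk (fun a => F a = true) x (a :: p) y ↔
      src a = x ∧ F a = true ∧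
        (mkSkeleton n k src tgt Z C).Walk (fun a => F a = true) (tgt a) p y := Iff.rfl
    exact this.trans ((and_congr_right fun _ => and_congr_right fun _ => ih).trans
      (by simp [walkB, and_assoc]))

/-- A description of the nonzero paths in a finite skeleton, in terms of tables. -/
theorem hasThinDet_mkSkeleton (F : Fin n → Fin k → Bool) (g : Fin n → Fin n → Option (List (Fin k)))
    (Zl : List (List (Fin k))) (Cl : List (List (Fin k) × List (Fin k)))
    (hZ : ∀ p, p ∈ Z ↔ p ∈ Zl) (hC : ∀ p, p ∈ C ↔ p ∈ Cl)
    (g_self : ∀ x, g x x = some [])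
    (d_src : ∀ x a, F x a → (g x (src a)).isSome)
    (d_tgt : ∀ x a, F x a → (g x (tgt a)).isSome)
    (tgt_ne : ∀ x a, F x a → tgt a ≠ x)
    (pathEq : ∀ x a, F x a → ((g x (src a)).getD [] ++ [a] = (g x (tgt a)).getD [] ∨
      ((g x (src a)).getD [] ++ [a], (g x (tgt a)).getD []) ∈ Cl))
    (isNull : ∀ x a, (g x (src a)).isSome → F x a = false →
      ∃ z ∈ Zl, z <:+ (g x (src a)).getD [] ++ [a])
    (walk : ∀ x y, (g x y).isSome → walkB src tgt (F x) x ((g x y).getD []) y)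
    (zero : ∀ p ∈ Zl, ∀ x y z, walkB src tgt (F x) y p z = false)
    (comm : ∀ p ∈ Cl, ∀ x y z, walkB src tgt (F x) y p.1 z = walkB src tgt (F x) y p.2 z)
    {D : ℤ}
    (hD : Matrix.det (Matrix.of fun x y : Fin n => if (g x y).isSome then (1 : ℤ) else 0) = D) :
    (mkSkeleton n k src tgt Z C).HasThinDet Set.univ D := by
  subst hD
  let P : ∀ x : Fin n, (mkSkeleton n k src tgt Z C).ThinAt Set.univ x := fun x =>
  { F a := F x a = true
    d y := (g x y).isSome = true
    g y := (g x y).getD []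
    d_self := by rw [g_self]; rfl
    g_self := by rw [g_self]; rfl
    mem_of_F _ := Set.mem_univ _
    d_src h := d_src x _ h
    d_tgt h := d_tgt x _ h
    tgt_ne h := tgt_ne x _ h
    pathEq {a} h := by
      rcases pathEq x a h with e | e
      · exact e ▸ .refl _
      · have h' := BoundQuiver.PathEq.comm (Q := mkSkeleton n k src tgt Z C) [] [] ((hC _).2 e)
        rw [List.append_nil, List.append_nil] at h'
        exact h'
    isNull {a} _ hd hF := by
      obtain ⟨z, hz, u, hu⟩ := isNull x a hd (by simpa using hF)
      have := BoundQuiver.IsNull.of_mem (Q := mkSkeleton n k src tgt Z C) ((hZ z).2 hz) u []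
      rw [List.append_nil] at this
      exact hu ▸ this
    walk h := walk_mkSkeleton.2 (walk x _ h)
    zero {p} hp _ y z w := by
      have := zero p ((hZ p).1 hp) x y z
      rw [walk_mkSkeleton.1 w] at this
      cases this
    comm {p q} h _ _ y z := by
      have := comm _ ((hC _).1 h) x y z
      exact walk_mkSkeleton.trans ((Bool.eq_iff_iff.1 this).trans walk_mkSkeleton.symm) }
  refine ⟨P, ?_⟩
  congr 1
  ext x y
  simp only [BoundQuiver.thinMatrix, P]
  congr

end Finite

lemma hasThinDet_skeletonI (k : Fin 3) : (skeletonI k).HasThinDet Set.univ 1 := by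
  have hZ : ∀ p : List (Fin 2), p ∈ (∅ : Set (List (Fin 2))) ↔ p ∈ ([] : List (List (Fin 2))) := by
    simp
  have hC : ∀ p : List (Fin 2) × List (Fin 2),
      p ∈ (∅ : Set (List (Fin 2) × List (Fin 2))) ↔
        p ∈ ([] : List (List (Fin 2) × List (Fin 2))) := by simp
  fin_cases k
  · exact hasThinDet_mkSkeleton (src := ![0, 2]) (tgt := ![2, 1])
      ![![true, true], ![false, false], ![false, true]]
      ![![some [], some [0, 1], some [0]], ![none, some [], none], ![none, some [1], some []]]
      [] [] hZ hC (by decide) (by decide) (by decide) (by decide) (by decide) (by decide)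
      (by decide) (by decide) (by decide) (by rw [Matrix.det_fin_three]; simp)
  · exact hasThinDet_mkSkeleton (src := ![0, 1]) (tgt := ![2, 2])
      ![![true, false], ![false, true], ![false, false]]
      ![![some [], none, some [0]], ![none, some [], some [1]], ![none, none, some []]]
      [] [] hZ hC (by decide) (by decide) (by decide) (by decide) (by decide) (by decide)
      (by decide) (by decide) (by decide) (by rw [Matrix.det_fin_three]; simp)
  · exact hasThinDet_mkSkeleton (src := ![2, 2]) (tgt := ![0, 1])
      ![![false, false], ![false, false], ![true, true]]
      ![![some [], none, none], ![none, some [], none], ![some [0], some [1], some []]]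
      [] [] hZ hC (by decide) (by decide) (by decide) (by decide) (by decide) (by decide)
      (by decide) (by decide) (by decide) (by rw [Matrix.det_fin_three]; simp)

lemma hasThinDet_skeletonII : skeletonII.HasThinDet Set.univ 2 := by
  exact hasThinDet_mkSkeleton (n := 4) (k := 5) (src := ![2, 1, 2, 0, 3])
    (tgt := ![1, 3, 0, 3, 2]) (Z := {[4, 0], [4, 2], [1, 4], [3, 4]}) (C := {([0, 1], [2, 3])})
    ![![false, false, false, true, false], ![false, true, false, false, false],
      ![true, true, true, true, false], ![false, false, false, false, true]]
    -- The path from `c'` to `c''` is represented by `[2, 3]`, not `[0, 1]`: the table check uses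
    -- the commutativity relation only from left to right.
    ![![some [], none, none, some [3]], ![none, some [], none, some [1]],
      ![some [2], some [0], some [], some [2, 3]], ![none, none, some [4], some []]]
    [[4, 0], [4, 2], [1, 4], [3, 4]] [([0, 1], [2, 3])] (by simp) (by simp)
    (by decide) (by decide) (by decide) (by decide) (by decide) (by decide)
    (by decide) (by decide) (by decide)
    (by simp [Matrix.det_succ_row_zero, Fin.sum_univ_succ, Fin.succAbove])

/-- Paths of length three vanish, so from every vertex exactly the paths of lengths 0, 1 and 2
survive. -/
lemma hasThinDet_skeletonIII : skeletonIII.HasThinDet Set.univ 3 := by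
  exact hasThinDet_mkSkeleton (n := 4) (k := 4) (src := ![2, 1, 3, 0])
    (tgt := ![1, 3, 0, 2]) (Z := {[0, 1, 2], [1, 2, 3], [2, 3, 0], [3, 0, 1]}) (C := ∅)
    ![![true, false, false, true], ![false, true, true, false],
      ![true, true, false, false], ![false, false, true, true]]
    ![![some [], some [3, 0], some [3], none], ![some [1, 2], some [], none, some [1]],
      ![none, some [0], some [], some [0, 1]], ![some [2], none, some [2, 3], some []]]
    [[0, 1, 2], [1, 2, 3], [2, 3, 0], [3, 0, 1]] [] (by simp) (by simp)
    (by decide) (by decide) (by decide) (by decide) (by decide) (by decide)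
    (by decide) (by decide) (by decide)
    (by simp [Matrix.det_succ_row_zero, Fin.sum_univ_succ, Fin.succAbove])

/-! ### The determinant of the skeleton of type IV -/

section DetIV

open Matrix

variable (m : ℕ) [NeZero m] (I : Finset (ZMod m))

/-- The permutation matrix of `i ↦ i - 1`. -/
def shiftMatrix : Matrix (ZMod m) (ZMod m) ℤ := fun i j => if j + 1 = i then 1 else 0

/-- The diagonal matrix of the indicator function of `I`. -/
def indMatrix : Matrix (ZMod m) (ZMod m) ℤ := diagonal fun i => if i ∈ I then 1 else 0

/-- The shift is an `m`-cycle of sign `(-1) ^ (m - 1)`, and negating `m` rows contributes `(-1) ^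
m`. -/
lemma det_neg_shiftMatrix : (-shiftMatrix m).det = -1 := by
  have hP : shiftMatrix m = ((Equiv.addRight (1 : ZMod m))⁻¹).permMatrix ℤ := by
    ext i j
    have : j + 1 = i ↔ i - 1 = j := by rw [sub_eq_iff_eq_add, eq_comm]
    simp [shiftMatrix, Equiv.Perm.permMatrix, PEquiv.toMatrix_apply, Equiv.toPEquiv_apply,
      ← sub_eq_add_neg, this]
  rw [det_neg, hP, det_permutation, Equiv.Perm.sign_inv, ZMod.card]
  obtain ⟨k, rfl⟩ : ∃ k, m = k + 1 := ⟨m - 1, by have := NeZero.pos m; omega⟩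
  have h : (Equiv.addRight (1 : ZMod (k + 1)) : Equiv.Perm (Fin (k + 1))) = finRotate (k + 1) :=
    Equiv.ext fun i => (finRotate_apply i).symm
  have hs : Equiv.Perm.sign (Equiv.addRight (1 : ZMod (k + 1))) = (-1) ^ k :=
    (congrArg Equiv.Perm.sign h).trans (sign_finRotate (k + 1))
  rw [hs]
  push_cast
  rw [← pow_add, show k + 1 + k = 2 * k + 1 by ring, pow_succ, pow_mul]
  simp

lemma indMatrix_mul_self : indMatrix m I * indMatrix m I = indMatrix m I := by
  rw [indMatrix, diagonal_mul_diagonal]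
  congr 1
  ext i
  split_ifs <;> simp

/-- The all-ones matrix. -/
def onesMatrix : Matrix (ZMod m) (ZMod m) ℤ := fun _ _ => 1

/-- The Cartan matrix of the skeleton of type IV, with isolated vertices added. -/
def extendedMatrix : Matrix (ZMod m ⊕ ZMod m) (ZMod m ⊕ ZMod m) ℤ :=
  fromBlocks (onesMatrix m - shiftMatrix m + shiftMatrix m * indMatrix m I)
    (shiftMatrix m * indMatrix m I) (indMatrix m I)
    (1 + indMatrix m I * shiftMatrix m * indMatrix m I)

/-- Since `X` is idempotent, adding the second block column times `1 - X` to the first turns the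
lower left block into the identity. A block row operation then makes the upper left block the
identity as well, and the Schur complement remains. -/
lemma det_extendedMatrix_eq : (extendedMatrix m I).det =
    (-shiftMatrix m + onesMatrix m * (1 + indMatrix m I * shiftMatrix m * indMatrix m I)).det := by
  have hX := indMatrix_mul_self m I
  unfold extendedMatrix
  set J := onesMatrix m
  set P := shiftMatrix m
  set X := indMatrix m I
  have h1 : (fromBlocks 1 (1 - (J - P + P * X)) 0 1 : Matrix (ZMod m ⊕ ZMod m) _ ℤ) *
      (fromBlocks (J - P + P * X) (P * X) X (1 + X * P * X) *
        fromBlocks 1 0 (1 - X) 1) =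
      fromBlocks 1 (P * X + (1 - (J - P + P * X)) * (1 + X * P * X)) 1 (1 + X * P * X) := by
    have e1 : P * X * (1 - X) = 0 := by rw [mul_assoc, mul_sub, mul_one, hX, sub_self, mul_zero]
    have e2 : (1 + X * P * X) * (1 - X) = 1 - X := by
      rw [add_mul, mul_assoc, mul_sub X, hX, mul_one, one_mul, sub_self, mul_zero, add_zero]
    rw [fromBlocks_multiply, fromBlocks_multiply]
    simp only [mul_one, mul_zero, zero_mul, one_mul, zero_add, add_zero, e1, e2, add_sub_cancel]
  have h2 := congrArg det h1
  rw [det_mul, det_mul, det_fromBlocks_zero₂₁, det_fromBlocks_zero₁₂, det_one, one_mul, one_mul,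
    mul_one, det_fromBlocks_one₁₁, one_mul] at h2
  rw [h2]
  congr 1
  -- Idempotence of `X` makes the contributions of `-P` and `P * X` to the product with `X * P * X`
  -- cancel.
  have e3 : P * X * (X * P * X) = P * (X * P * X) := by
    rw [mul_assoc, ← mul_assoc X (X * P) X, ← mul_assoc X X P, hX]
  have e4 : (J - P + P * X) * (1 + X * P * X) = J - P + P * X + J * (X * P * X) := by
    rw [mul_add, mul_one, add_mul, sub_mul, e3]; abel
  rw [sub_mul, e4, one_mul, mul_add J, mul_one]
  abel

lemma det_extendedMatrix : (extendedMatrix m I).det = (m : ℤ) + sharedVertices m I - 1 := by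
  rw [det_extendedMatrix_eq]
  -- `w j` is the sum of column `j` of `1 + X P X`; the all-ones matrix repeats these sums in every
  -- row.
  let w : ZMod m → ℤ := fun j => 1 + if j ∈ I ∧ j + 1 ∈ I then 1 else 0
  have hJ : onesMatrix m * (1 + indMatrix m I * shiftMatrix m * indMatrix m I) =
      replicateCol Unit (fun _ => (1 : ℤ)) * replicateRow Unit w := by
    have hN (s j : ZMod m) : (1 + indMatrix m I * shiftMatrix m * indMatrix m I) s j =
        (if s = j then 1 else 0) + if j + 1 = s ∧ j ∈ I ∧ s ∈ I then 1 else 0 := by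
      simp only [indMatrix, shiftMatrix, Matrix.add_apply, one_apply, mul_diagonal, diagonal_mul]
      congr 1
      by_cases h : j ∈ I <;> by_cases h' : s ∈ I <;> simp [h, h']
    ext i j
    rw [mul_apply]
    simp only [onesMatrix, one_mul, hN, Finset.sum_add_distrib]
    simp only [mul_apply, replicateCol_apply, replicateRow_apply, Finset.univ_unique, one_mul,
      Finset.sum_const, Finset.card_singleton, one_smul, w]
    congr 1
    · simp
    · rw [Finset.sum_eq_single (j + 1)]
      · simp
      · intro s _ hs
        simp [Ne.symm hs]
      · simp
  -- A permutation matrix fixes the all-ones column, so `-P` factors out and the matrix determinant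
  -- lemma applies.
  have hP : -shiftMatrix m + replicateCol Unit (fun _ => (1 : ℤ)) * replicateRow Unit w =
      -shiftMatrix m * (1 + replicateCol Unit (fun _ => (-1 : ℤ)) * replicateRow Unit w) := by
    rw [mul_add, mul_one, ← Matrix.mul_assoc]
    congr 2
    ext i j
    simp [mul_apply, shiftMatrix, ← eq_sub_iff_add_eq]
  rw [hJ, hP, det_mul, det_neg_shiftMatrix, det_one_add_replicateCol_mul_replicateRow]
  have hsum : w ⬝ᵥ (fun _ => (-1 : ℤ)) = -((m : ℤ) + sharedVertices m I) := by
    have : ∑ j, w j = (m : ℤ) + sharedVertices m I := by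
      simp only [w, Finset.sum_add_distrib, Finset.sum_boole, sharedVertices]
      congr 1
      · simp [ZMod.card]
      · norm_cast
        refine Finset.card_bij (fun j _ => j + 1) ?_ ?_ ?_
        · intro j hj; simp at hj ⊢; exact ⟨hj.2, hj.1⟩
        · intro j _ j' _ h; simpa using h
        · intro v hv; simp at hv; exact ⟨v - 1, by simpa using ⟨hv.2, hv.1⟩, by simp⟩
    rw [← this]
    simp [dotProduct]
  rw [hsum]
  ring

end DetIV

/-! ### The skeleton of type IV -/

section SkeletonIV

open BoundQuiver

variable {m : ℕ} [NeZero m] {I : Finset (ZMod m)}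

omit [NeZero m] in
lemma zmod_add_one_ne (hm : 3 ≤ m) (j : ZMod m) : j + 1 ≠ j := by
  have : Fact (1 < m) := ⟨by omega⟩
  simp

lemma zmod_add_val (i j : ZMod m) : i + ((j - i).val : ZMod m) = j := by
  rw [ZMod.natCast_zmod_val]; ring

omit [NeZero m] in
lemma zmod_val_sub {i j : ZMod m} {n : ℕ} (hn : n < m) (h : i + (n : ZMod m) = j) :
    (j - i).val = n := by
  rw [← h, add_sub_cancel_left, ZMod.val_natCast_of_lt hn]

lemma zmod_val_add_one {i j : ZMod m} (h : j + 1 ≠ i) : (j + 1 - i).val = (j - i).val + 1 := by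
  have h1 : i + (((j - i).val + 1 : ℕ) : ZMod m) = j + 1 := by
    push_cast
    rw [← add_assoc, zmod_add_val]
  refine zmod_val_sub ?_ h1
  by_contra hlt
  have : (j - i).val + 1 = m := by have := ZMod.val_lt (j - i); omega
  rw [this, ZMod.natCast_self, add_zero] at h1
  exact h h1.symm

lemma zmod_val_eq_sub_one {i j : ZMod m} (h : j + 1 = i) : (j - i).val = m - 1 := by
  have hm := NeZero.pos m
  refine zmod_val_sub (by omega) ?_
  rw [Nat.cast_sub hm, ZMod.natCast_self, ← h]
  push_cast
  ring

variable (I) in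
/-- The path of length `n` along the central cycle which starts at `i`. -/
def cyclePath (i : ZMod m) (n : ℕ) : List (ArrowIV m I) :=
  (List.range n).map fun k : ℕ => ArrowIV.cyc m I (i + (k : ZMod m))

omit [NeZero m] in
lemma longPath_eq_cyclePath (i : ZMod m) : longPath m I i = cyclePath I (i + 1) (m - 1) := by
  simp [longPath, cyclePath, ← List.map_eq_flatMap]

omit [NeZero m] in
lemma cyclePath_succ (i : ZMod m) (n : ℕ) :
    cyclePath I i (n + 1) = cyclePath I i n ++ [ArrowIV.cyc m I (i + (n : ZMod m))] := by
  simp [cyclePath, List.range_succ]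

lemma cyclePath_val_add_one {i j : ZMod m} (h : j + 1 ≠ i) :
    cyclePath I i (j + 1 - i).val = cyclePath I i (j - i).val ++ [ArrowIV.cyc m I j] := by
  rw [zmod_val_add_one h, cyclePath_succ, zmod_add_val]

lemma cyclePath_eq_longPath {i j : ZMod m} (h : j + 1 = i) :
    cyclePath I i (j - i).val = longPath m I j := by
  rw [zmod_val_eq_sub_one h, ← h, longPath_eq_cyclePath]

/-- The long path omits only the cycle arrow leaving `i`, so one forbidden arrow elsewhere on the
cycle rules out walking along it. -/
lemma mem_longPath {i j : ZMod m} (h : j ≠ i) : ArrowIV.cyc m I j ∈ longPath m I i := by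
  rw [longPath_eq_cyclePath]
  refine List.mem_map.2 ⟨(j - (i + 1)).val, List.mem_range.2 ?_, ?_⟩
  · have h1 := ZMod.val_lt (j - (i + 1))
    have h2 : (j - (i + 1)).val ≠ m - 1 := by
      intro h2
      have h3 := zmod_add_val (i + 1) j
      rw [h2, ← zmod_val_eq_sub_one (i := i + 1) rfl, zmod_add_val] at h3
      exact h h3.symm
    omega
  · rw [zmod_add_val]

omit [NeZero m] in
lemma longPath_eq_cons (hm : 3 ≤ m) (i : ZMod m) :
    ∃ p, longPath m I i = ArrowIV.cyc m I (i + 1) :: p := by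
  obtain ⟨n, hn⟩ : ∃ n, m - 1 = n + 1 := ⟨m - 2, by omega⟩
  rw [longPath_eq_cyclePath, cyclePath, hn, List.range_succ_eq_map, List.map_cons, Nat.cast_zero,
    add_zero]
  exact ⟨_, rfl⟩

lemma pathEq_longPath (s : I) :
    (skeletonIV m I).PathEq [ArrowIV.out m I s, ArrowIV.back m I s] (longPath m I s.1) := by
  have h := PathEq.comm (Q := skeletonIV m I) [] [] ⟨s, rfl⟩
  rw [List.append_nil, List.append_nil] at h
  exact h

lemma isNull_cyc_out (s : I) (p : List (ArrowIV m I)) :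
    (skeletonIV m I).IsNull (p ++ [ArrowIV.cyc m I s.1, ArrowIV.out m I s]) := by
  have h := IsNull.of_mem (Q := skeletonIV m I) (Or.inl (Or.inl ⟨s, rfl⟩)) p []
  rw [List.append_nil] at h
  exact h

lemma isNull_back_cyc (s : I) (p q : List (ArrowIV m I)) :
    (skeletonIV m I).IsNull (p ++ [ArrowIV.back m I s, ArrowIV.cyc m I s.1] ++ q) :=
  IsNull.of_mem (Q := skeletonIV m I) (Or.inl (Or.inr ⟨s, rfl⟩)) p q

lemma isNull_longPath {i : ZMod m} (h : i ∉ I) : (skeletonIV m I).IsNull (longPath m I i) := by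
  have h := IsNull.of_mem (Q := skeletonIV m I) (Or.inr ⟨i, h, rfl⟩) [] []
  rw [List.append_nil] at h
  exact h

/-! ### Nonzero paths from a vertex of the central cycle -/

variable (I) in
/-- The arrows which extend nonzero paths from the vertex `i` of the central cycle. -/
def cycleF (i : ZMod m) : ArrowIV m I → Prop :=
  Sum.elim (fun j => j + 1 ≠ i ∧ (j + 1 + 1 = i → j + 1 ∈ I))
    (Sum.elim (fun s => s.1 + 1 = i) (fun s => s.1 + 1 = i))

variable (I) in
/-- The ends of nonzero paths from the vertex `i` of the central cycle. -/
def cycleD (i : ZMod m) : ZMod m ⊕ I → Prop :=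
  Sum.elim (fun j => j + 1 = i → j ∈ I) (fun s => s.1 + 1 = i)

variable (I) in
/-- The nonzero paths from the vertex `i` of the central cycle. -/
def cycleG (i : ZMod m) : ZMod m ⊕ I → List (ArrowIV m I) :=
  Sum.elim (fun j => cyclePath I i (j - i).val) (fun s => [ArrowIV.out m I s])

lemma walk_cyclePath (F : ArrowIV m I → Prop) (i : ZMod m) {n : ℕ}
    (h : ∀ k < n, F (ArrowIV.cyc m I (i + (k : ZMod m)))) :
    (skeletonIV m I).Walk F (Sum.inl i : ZMod m ⊕ I) (cyclePath I i n)
      (Sum.inl (i + (n : ZMod m)) : ZMod m ⊕ I) := by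
  induction n with
  | zero => rw [Nat.cast_zero, add_zero]; rfl
  | succ n ih =>
    rw [cyclePath_succ]
    refine (ih fun k hk => h k (by omega)).append ⟨rfl, h n (by omega), ?_⟩
    change (Sum.inl (i + (n : ZMod m) + 1) : ZMod m ⊕ I) = Sum.inl (i + ((n + 1 : ℕ) : ZMod m))
    push_cast
    rw [add_assoc]

/-- This lets the two sides of a commutativity relation be compared through one known walk along
each. -/
lemma walk_unique {Q : BoundQuiver} {F : Q.E → Prop} {x y z w : Q.V} {p : List Q.E} (hp : p ≠ [])
    (h : Q.Walk F x p y) (h' : Q.Walk F z p w) : x = z ∧ y = w := by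
  induction p generalizing x z with
  | nil => exact absurd rfl hp
  | cons a p ih =>
    refine ⟨h.1.symm.trans h'.1, ?_⟩
    by_cases hp : p = []
    · subst hp
      exact h.2.2.symm.trans h'.2.2
    · exact (ih hp h.2.2 h'.2.2).2

/-- A walk of length less than `m` never uses the arrow into `i`, and only its last step can reach
`i - 1`, where the hypothesis applies. -/
lemma walk_cycle {i j : ZMod m} (h : j + 1 = i → j ∈ I) :
    (skeletonIV m I).Walk (cycleF I i) (Sum.inl i : ZMod m ⊕ I) (cyclePath I i (j - i).val)
      (Sum.inl j : ZMod m ⊕ I) := by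
  have hw := walk_cyclePath (I := I) (cycleF I i) i (n := (j - i).val) ?_
  · rwa [zmod_add_val] at hw
  · intro k hk
    have hlt := ZMod.val_lt (j - i)
    have key (l : ℕ) (hl : l < m) (hl0 : 0 < l) : i + (l : ZMod m) ≠ i := by
      intro e
      have := zmod_val_sub hl e
      rw [sub_self, ZMod.val_zero] at this
      omega
    have e1 : i + (k : ZMod m) + 1 = i + ((k + 1 : ℕ) : ZMod m) := by push_cast; ring
    refine ⟨e1 ▸ key _ (by omega) (by omega), fun e => ?_⟩
    have hk2 : k + 1 = (j - i).val := by
      by_contra hne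
      have e3 : i + ((k + 1 + 1 : ℕ) : ZMod m) = i + (k : ZMod m) + 1 + 1 := by push_cast; ring
      exact key (k + 1 + 1) (by omega) (by omega) (e3.trans e)
    have e2 : i + (k : ZMod m) + 1 = j := by rw [e1, hk2, zmod_add_val]
    rw [e2] at e ⊢
    exact h e

/-- The nonzero paths from a vertex of the central cycle. -/
def thinAtCycle (hm : 3 ≤ m) (i : ZMod m) :
    (skeletonIV m I).ThinAt Set.univ (Sum.inl i : ZMod m ⊕ I) where
  F := cycleF I i
  d := cycleD I i
  g := cycleG I i
  d_self h := absurd h (zmod_add_one_ne hm i)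
  g_self := by
    change cyclePath I i (i - i).val = []
    rw [sub_self, ZMod.val_zero]
    rfl
  mem_of_F _ := Set.mem_univ _
  d_src {a} h := by
    rcases a with j | s | s
    · exact fun e => absurd e h.1
    · exact h
    · have h' : s.1 + 1 = i := h
      exact fun e => absurd (h' ▸ e) (zmod_add_one_ne hm i)
  d_tgt {a} h := by
    rcases a with j | s | s
    · exact h.2
    · exact fun _ => s.2
    · exact h
  tgt_ne {a} h := by
    rcases a with j | s | s
    · exact fun e => h.1 (Sum.inl_injective e)
    · intro e
      have h' : s.1 + 1 = i := h
      rw [← h'] at e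
      exact zmod_add_one_ne hm s.1 (Sum.inl_injective e).symm
    · exact Sum.inr_ne_inl
  pathEq {a} h := by
    rcases a with j | s | s
    · change (skeletonIV m I).PathEq (cyclePath I i (j - i).val ++ [ArrowIV.cyc m I j])
        (cyclePath I i (j + 1 - i).val)
      rw [cyclePath_val_add_one h.1]
      exact .refl _
    · change (skeletonIV m I).PathEq [ArrowIV.out m I s, ArrowIV.back m I s]
        (cyclePath I i (s.1 - i).val)
      rw [cyclePath_eq_longPath h]
      exact pathEq_longPath s
    · change (skeletonIV m I).PathEq (cyclePath I i (s.1 + 1 - i).val ++ [ArrowIV.out m I s])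
        [ArrowIV.out m I s]
      have h' : s.1 + 1 = i := h
      rw [h', sub_self, ZMod.val_zero]
      exact .refl _
  isNull {a} _ hd hF := by
    rcases a with j | s | s
    · change (skeletonIV m I).IsNull (cyclePath I i (j - i).val ++ [ArrowIV.cyc m I j])
      by_cases hj : j + 1 = i
      · rw [cyclePath_eq_longPath hj]
        have hjI : j ∈ I := hd hj
        -- The long path equals the path through the spike at `j`, whose second arrow followed by `j
        -- → j + 1` is zero.
        refine (isNull_back_cyc ⟨j, hjI⟩ [ArrowIV.out m I ⟨j, hjI⟩] []).of_pathEq ?_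
        exact ((pathEq_longPath ⟨j, hjI⟩).append [] [ArrowIV.cyc m I j]).symm
      -- The prolonged path is the long path ending at `j + 1 = i - 1`, which is zero as there is no
      -- spike there.
      · have hj2 : ¬ (j + 1 + 1 = i → j + 1 ∈ I) := fun h => hF ⟨hj, h⟩
        rw [Classical.not_imp] at hj2
        rw [← cyclePath_val_add_one hj, cyclePath_eq_longPath hj2.1]
        exact isNull_longPath hj2.2
    · exact absurd hd hF
    · change (skeletonIV m I).IsNull (cyclePath I i (s.1 + 1 - i).val ++ [ArrowIV.out m I s])
      rw [cyclePath_val_add_one hF, List.append_assoc]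
      exact isNull_cyc_out s _
  walk {y} h := by
    rcases y with j | s
    · exact walk_cycle h
    · have h' : s.1 + 1 = i := h
      exact ⟨congrArg Sum.inl h', h', rfl⟩
  zero {p} hp _ y z w := by
    rcases hp with (⟨s, rfl⟩ | ⟨s, rfl⟩) | ⟨j, hj, rfl⟩
    · exact w.2.1.1 w.2.2.2.1
    · exact w.2.2.2.1.1 w.2.1
    · have hF := w.forall
      -- A long path starting at `i` fails at its last arrow, into `j = i - 1`, because `j ∉ I`; any
      -- other contains the forbidden arrow into `i`.
      by_cases hji : j + 1 = i
      · have h1 : j - 1 ≠ j := fun e => zmod_add_one_ne hm j (by rw [sub_eq_iff_eq_add] at e; exact e.symm)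
        have h2 := (hF _ (mem_longPath h1)).2
        rw [sub_add_cancel] at h2
        exact hj (h2 hji)
      · have h1 : i - 1 ≠ j := fun e => hji (by rw [← e, sub_add_cancel])
        exact (hF _ (mem_longPath h1)).1 (sub_add_cancel _ _)
  comm {p q} hpq _ _ y z := by
    obtain ⟨s, hs⟩ := hpq
    obtain ⟨rfl, rfl⟩ := Prod.mk.inj hs
    -- If `s + 1 = i`, both sides are walks from `i` to `s`. Otherwise neither is a walk, the long
    -- path again containing the arrow into `i`.
    by_cases hsi : s.1 + 1 = i
    · have w1 : (skeletonIV m I).Walk (cycleF I i) (Sum.inl i : ZMod m ⊕ I)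
          [ArrowIV.out m I s, ArrowIV.back m I s] (Sum.inl s.1 : ZMod m ⊕ I) :=
        ⟨congrArg Sum.inl hsi, hsi, rfl, hsi, rfl⟩
      have w2 := walk_cycle (I := I) (i := i) (j := s.1) fun _ => s.2
      rw [cyclePath_eq_longPath hsi] at w2
      constructor
      · intro w
        obtain ⟨rfl, rfl⟩ := walk_unique (List.cons_ne_nil _ _) w1 w
        exact w2
      · intro w
        obtain ⟨p, hp⟩ := longPath_eq_cons (I := I) hm s.1
        obtain ⟨rfl, rfl⟩ := walk_unique (hp ▸ List.cons_ne_nil _ _) w2 w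
        exact w1
    · refine ⟨fun w => absurd w.2.1 hsi, fun w => ?_⟩
      have h1 : i - 1 ≠ s.1 := fun e => hsi (by rw [← e, sub_add_cancel])
      exact absurd (sub_add_cancel _ _) (w.forall _ (mem_longPath h1)).1

/-! ### Nonzero paths from the outer vertex of a spike -/

variable (I) in
/-- The arrows which extend nonzero paths from the outer vertex of the spike at `s`. -/
def spikeF (s : I) : ArrowIV m I → Prop :=
  Sum.elim (fun _ => False) (Sum.elim (fun t => t = s) (fun t => t.1 + 1 = s.1))

variable (I) in
/-- The ends of nonzero paths from the outer vertex of the spike at `s`. -/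
def spikeD (s : I) : ZMod m ⊕ I → Prop :=
  Sum.elim (fun j => j = s.1) (fun t => t = s ∨ t.1 + 1 = s.1)

variable (I) in
/-- The nonzero paths from the outer vertex of the spike at `s`. -/
def spikeG (s : I) : ZMod m ⊕ I → List (ArrowIV m I) :=
  Sum.elim (fun _ => [ArrowIV.back m I s])
    (fun t => if t = s then [] else [ArrowIV.back m I s, ArrowIV.out m I t])

/-- The nonzero paths from the outer vertex of a spike. -/
def thinAtSpike (hm : 3 ≤ m) (s : I) :
    (skeletonIV m I).ThinAt Set.univ (Sum.inr s : ZMod m ⊕ I) := by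
  have hne {t : I} (h : t.1 + 1 = s.1) : t ≠ s := by
    rintro rfl
    exact zmod_add_one_ne hm _ h
  have hgs : spikeG I s (Sum.inr s) = [] := if_pos rfl
  have hgt {t : I} (h : t.1 + 1 = s.1) :
      spikeG I s (Sum.inr t) = [ArrowIV.back m I s, ArrowIV.out m I t] := if_neg (hne h)
  exact
  { F := spikeF I s
    d := spikeD I s
    g := spikeG I s
    d_self := Or.inl rfl
    g_self := hgs
    mem_of_F _ := Set.mem_univ _
    d_src {a} h := by
      rcases a with j | t | t
      · exact h.elim
      · exact Or.inl h
      · exact h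
    d_tgt {a} h := by
      rcases a with j | t | t
      · exact h.elim
      · exact congrArg Subtype.val h
      · exact Or.inr h
    tgt_ne {a} h := by
      rcases a with j | t | t
      · exact h.elim
      · exact Sum.inl_ne_inr
      · exact fun e => hne h (Sum.inr_injective e)
    pathEq {a} h := by
      rcases a with j | t | t
      · exact h.elim
      · obtain rfl : t = s := h
        change (skeletonIV m I).PathEq (spikeG I t (Sum.inr t) ++ [ArrowIV.back m I t])
          [ArrowIV.back m I t]
        rw [hgs]
        exact .refl _
      · change (skeletonIV m I).PathEq [ArrowIV.back m I s, ArrowIV.out m I t]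
          (spikeG I s (Sum.inr t))
        rw [hgt h]
        exact .refl _
    isNull {a} _ hd hF := by
      rcases a with j | t | t
      · obtain rfl : j = s.1 := hd
        exact isNull_back_cyc s [] []
      · have ht : t.1 + 1 = s.1 := hd.resolve_left hF
        change (skeletonIV m I).IsNull (spikeG I s (Sum.inr t) ++ [ArrowIV.back m I t])
        rw [hgt ht]
        -- Continuing from `c_t` to `t` amounts to following the long path from `t + 1 = s`. Its
        -- first arrow leaves `s` along the cycle and is killed by the preceding `c_s → s`.
        obtain ⟨p, hp⟩ := longPath_eq_cons (I := I) hm t.1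
        have h1 := (pathEq_longPath t).append [ArrowIV.back m I s] []
        rw [hp, ht] at h1
        have h2 := isNull_back_cyc s [] p
        refine IsNull.of_pathEq h2 ?_
        rw [List.append_nil, List.append_nil] at h1
        exact h1
      · exact absurd hd hF
    walk {y} h := by
      rcases y with j | t
      · obtain rfl : j = s.1 := h
        exact ⟨rfl, rfl, rfl⟩
      · rcases h with rfl | h
        · rw [hgs]; rfl
        · rw [hgt h]
          exact ⟨rfl, rfl, congrArg Sum.inl h, h, rfl⟩
    zero {p} hp _ y z w := by
      rcases hp with (⟨t, rfl⟩ | ⟨t, rfl⟩) | ⟨j, hj, rfl⟩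
      · exact w.2.1
      · exact w.2.2.2.1
      · obtain ⟨p, hp⟩ := longPath_eq_cons (I := I) hm j
        rw [hp] at w
        exact w.2.1
    comm {p q} hpq _ _ y z := by
      obtain ⟨t, ht⟩ := hpq
      obtain ⟨rfl, rfl⟩ := Prod.mk.inj ht
      refine ⟨fun w => absurd w.2.2.2.1 (hne w.2.1), fun w => ?_⟩
      obtain ⟨p, hp⟩ := longPath_eq_cons (I := I) hm t.1
      rw [hp] at w
      exact w.2.1.elim }

/-- Adding an isolated outer vertex for every index outside `I` makes all blocks square of size `m`
without changing the determinant. The paths `c_s → s → c_{s-1}` between adjacent spikes give the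
term `X P X`, the source of `c(Q)`. -/
theorem hasThinDet_skeletonIV (hm : 3 ≤ m) (I : Finset (ZMod m)) :
    (skeletonIV m I).HasThinDet Set.univ ((m : ℤ) + sharedVertices m I - 1) := by
  let P : ∀ x : ZMod m ⊕ I, (skeletonIV m I).ThinAt Set.univ x := fun x =>
    match x with
    | Sum.inl i => thinAtCycle hm i
    | Sum.inr s => thinAtSpike hm s
  refine ⟨P, ?_⟩
  have hf : Function.Injective (Sum.map id Subtype.val : ZMod m ⊕ I → ZMod m ⊕ ZMod m) :=
    Sum.map_injective.2 ⟨Function.injective_id, Subtype.val_injective⟩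
  rw [← det_extendedMatrix, det_eq_det_submatrix hf]
  · congr 1
    have hP {x y : (skeletonIV m I).V} {p : Prop} [Decidable p] (h : (P x).d y ↔ p) :
        thinMatrix P x y = if p then 1 else 0 := by
      simp only [thinMatrix, h]
    ext x y
    rcases x with i | s <;> rcases y with j | t
    · refine (hP (p := j + 1 = i → j ∈ I) Iff.rfl).trans ?_
      by_cases h1 : j + 1 = i <;> by_cases h2 : j ∈ I <;>
        simp [extendedMatrix, onesMatrix, shiftMatrix, indMatrix, h1, h2]
    · refine (hP (p := t.1 + 1 = i) Iff.rfl).trans ?_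
      simp [extendedMatrix, shiftMatrix, indMatrix]
    · refine (hP (p := j = s.1) Iff.rfl).trans ?_
      simp [extendedMatrix, indMatrix, Matrix.diagonal_apply, eq_comm]
    · refine (hP (p := t = s ∨ t.1 + 1 = s.1) Iff.rfl).trans ?_
      have hne : (1 : ZMod m) ≠ 0 := by
        have : Fact (1 < m) := ⟨by omega⟩
        exact one_ne_zero
      by_cases h : t = s
      · subst h
        simp [extendedMatrix, shiftMatrix, indMatrix, hne]
      · have h' : s.1 ≠ t.1 := fun e => h (Subtype.ext e.symm)
        simp [extendedMatrix, shiftMatrix, indMatrix, h, h']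
  · rintro (i | i) (j | j) h
    · simp at h
    · have hj : j ∉ I := by simpa using h
      simp [extendedMatrix, indMatrix, hj]
    · have hi : i ∉ I := by simpa using h
      simp [extendedMatrix, indMatrix, hi, Matrix.diagonal_apply]
    · have hij : i ∉ I ∨ j ∉ I := by simpa using h
      rcases hij with hi | hj
      · simp [extendedMatrix, indMatrix, hi, Matrix.one_apply, Matrix.mul_assoc]
      · simp [extendedMatrix, indMatrix, hj, Matrix.one_apply]

end SkeletonIV

/-! ### Cluster-tilted algebras of type `D` -/

variable (K : Type*) [Field K]

lemma RootedTypeA.det_cartan (R : RootedTypeA) : (R.bound.cartan K).det = 2 ^ R.triangles :=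
  R.hasThinDet.det_cartan K

lemma det_cartan_glue {S : BoundQuiver} {J : Type} [Fintype J] [DecidableEq J] (c : J → S.V)
    (Q : J → RootedTypeA) {D : ℤ} (hS : S.HasThinDet Set.univ D) (hz : ∀ p ∈ S.zeroRel, p ≠ [])
    (hc : ∀ p q, (p, q) ∈ S.commRel → p ≠ [] ∧ q ≠ []) :
    ((glue S c Q).cartan K).det = D * ∏ j, 2 ^ (Q j).triangles :=
  (hasThinDet_glue S c Q hS (fun j => (Q j).hasThinDet) hz hc).det_cartan K

lemma det_cartan_typeI (k : Fin 3) (Q' : RootedTypeA) :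
    ((typeI k Q').cartan K).det = 2 ^ Q'.triangles := by
  have h := det_cartan_glue K (S := skeletonI k) (J := Fin 1) (fun _ => (2 : Fin 3)) (fun _ => Q')
    (hasThinDet_skeletonI k) (fun p hp => hp.elim) (fun p q hp => hp.elim)
  rw [Fin.prod_univ_one, one_mul] at h
  exact h

lemma det_cartan_typeII (Q' Q'' : RootedTypeA) :
    ((typeII Q' Q'').cartan K).det = 2 * 2 ^ (Q'.triangles + Q''.triangles) := by
  have h := det_cartan_glue K (S := skeletonII) (J := Fin 2) (![2, 3] : Fin 2 → Fin 4) ![Q', Q'']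
    hasThinDet_skeletonII
    (by rintro p (rfl | rfl | rfl | rfl) <;> exact List.cons_ne_nil _ _)
    (fun p q hp => by
      obtain ⟨rfl, rfl⟩ := Prod.mk.inj (Set.mem_singleton_iff.1 hp)
      exact ⟨List.cons_ne_nil _ _, List.cons_ne_nil _ _⟩)
  rw [Fin.prod_univ_two] at h
  rw [pow_add]
  exact h

lemma det_cartan_typeIII (Q' Q'' : RootedTypeA) :
    ((typeIII Q' Q'').cartan K).det = 3 * 2 ^ (Q'.triangles + Q''.triangles) := by
  have h := det_cartan_glue K (S := skeletonIII) (J := Fin 2) (![2, 3] : Fin 2 → Fin 4) ![Q', Q'']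
    hasThinDet_skeletonIII
    (by rintro p (rfl | rfl | rfl | rfl) <;> exact List.cons_ne_nil _ _)
    (fun p q hp => hp.elim)
  rw [Fin.prod_univ_two] at h
  rw [pow_add]
  exact h

lemma det_cartan_typeIV {m : ℕ} [NeZero m] (hm : 3 ≤ m) (I : Finset (ZMod m))
    (Q : I → RootedTypeA) : ((typeIV m I Q).cartan K).det =
      ((m : ℤ) + sharedVertices m I - 1) * ∏ j : I, 2 ^ (Q j).triangles := by
  refine det_cartan_glue K (S := skeletonIV m I) (fun i => (Sum.inr i : ZMod m ⊕ I)) Q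
    (hasThinDet_skeletonIV hm I) ?_ ?_
  · rintro p ((⟨i, rfl⟩ | ⟨i, rfl⟩) | ⟨i, _, rfl⟩)
    · exact List.cons_ne_nil _ _
    · exact List.cons_ne_nil _ _
    · obtain ⟨q, hq⟩ := longPath_eq_cons (I := I) hm i
      rw [hq]
      exact List.cons_ne_nil _ _
  · rintro p q ⟨i, hi⟩
    obtain ⟨rfl, rfl⟩ := Prod.mk.inj hi
    obtain ⟨q, hq⟩ := longPath_eq_cons (I := I) hm i.1
    rw [hq]
    exact ⟨List.cons_ne_nil _ _, List.cons_ne_nil _ _⟩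

end ClusterTilted

theorem theorem2p4 (K : Type*) [Field K] :
    -- type I
    (∀ (k : Fin 3) (Q' : ClusterTilted.RootedTypeA),
      ((ClusterTilted.typeI k Q').cartan K).det = 2 ^ Q'.triangles ∧
      ((ClusterTilted.typeI k Q').cartan K).det = (Q'.bound.cartan K).det) ∧
    -- type II
    (∀ Q' Q'' : ClusterTilted.RootedTypeA,
      ((ClusterTilted.typeII Q' Q'').cartan K).det = 2 * 2 ^ (Q'.triangles + Q''.triangles) ∧
      ((ClusterTilted.typeII Q' Q'').cartan K).det =
        2 * (Q'.bound.cartan K).det * (Q''.bound.cartan K).det) ∧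
    -- type III
    (∀ Q' Q'' : ClusterTilted.RootedTypeA,
      ((ClusterTilted.typeIII Q' Q'').cartan K).det = 3 * 2 ^ (Q'.triangles + Q''.triangles) ∧
      ((ClusterTilted.typeIII Q' Q'').cartan K).det =
        3 * (Q'.bound.cartan K).det * (Q''.bound.cartan K).det) ∧
    -- type IV, with central cycle of length `m` and spikes at the elements of `I`
    (∀ (m : ℕ) [NeZero m] (_ : 3 ≤ m) (I : Finset (ZMod m)) (Q : I → ClusterTilted.RootedTypeA),
      ((ClusterTilted.typeIV m I Q).cartan K).det =
        ((m : ℤ) + ClusterTilted.sharedVertices m I - 1) * ∏ j : I, 2 ^ (Q j).triangles ∧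
      ((ClusterTilted.typeIV m I Q).cartan K).det =
        ((m : ℤ) + ClusterTilted.sharedVertices m I - 1) *
          ∏ j : I, ((Q j).bound.cartan K).det) := by
  refine ⟨fun k Q' => ?_, fun Q' Q'' => ?_, fun Q' Q'' => ?_, fun m _ hm I Q => ?_⟩
  · simp only [ClusterTilted.det_cartan_typeI, ClusterTilted.RootedTypeA.det_cartan, and_self]
  · simp only [ClusterTilted.det_cartan_typeII, ClusterTilted.RootedTypeA.det_cartan, pow_add,
      mul_assoc, and_self]
  · simp only [ClusterTilted.det_cartan_typeIII, ClusterTilted.RootedTypeA.det_cartan, pow_add,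
      mul_assoc, and_self]
  · simp only [ClusterTilted.det_cartan_typeIV K hm, ClusterTilted.RootedTypeA.det_cartan, and_self]
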